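/- Let $d,m\ge 0$ be integers, $T>0$, $0<\alpha<\tfrac12$, $\alpha<\beta\le 1$, $\gamma\in[0,1]$, $M_0,K_0,L_0>0$ and $B\ge 0$. Let $\varphi=\varphi(\gamma,\alpha)$ be a number with $\varphi=2\alpha$ if $\gamma=1$; $1+\frac{2\alpha-1}{\gamma}<\varphi\le 2\alpha$ if $\frac{1-2\alpha}{1-\alpha}\le\gamma<1$; $\varphi=\alpha$ if $0\le\gamma<\frac{1-2\alpha}{1-\alpha}$. **Notation.** For $f:[a,b]\to\mathbb R^d$ put $$\|f\|_{\alpha,\infty(a,b)}=\sup_{t\in[a,b]}\Big(|f(t)|+\int_a^t\frac{|f(t)-f(s)|}{(t-s)^{\alpha+1}}\,ds\Big),$$ let $W_0^{\alpha,\infty}(a,b;\mathbb R^d)$ be the space of measurable $f$ for which this is finite, and write $\|f\|_{\alpha,\infty(r)}=\|f\|_{\alpha,\infty(-r,T)}$. Let $C^{\nu}(a,b;\mathbb R^d)$ be the space of $\nu$-Hölder continuous functions on $[a,b]$, and $C(-r,T;\mathbb R^d)$ that of continuous functions on $[-r,T]$, with the sup norm $\|\cdot\|_{\infty(r)}$.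 Let $W_T^{1-\alpha,\infty}(0,T;\mathbb R^m)$ be the space of measurable $g:[0,T]\to\mathbb R^m$ with $$\sup_{0<s<t<T}\Big(\frac{|g(t)-g(s)|}{(t-s)^{1-\alpha}}+\int_s^t\frac{|g(u)-g(s)|}{(u-s)^{2-\alpha}}\,du\Big)<\infty .$$ For such $g$, with $D^{1-\alpha}_{t-}g_{t-}(s)=\frac{(-1)^{1-\alpha}}{\Gamma(\alpha)}\Big(\frac{g(s)-g(t-)}{(t-s)^{1-\alpha}}+(1-\alpha)\int_s^t\frac{g(s)-g(u)}{(u-s)^{2-\alpha}}du\Big)$, put $\Lambda_\alpha(g)=\frac1{\Gamma(1-\alpha)}\sup_{0<s<t<T}|D^{1-\alpha}_{t-}g_{t-}(s)|$. The integral with respect to $g$ is the generalized Stieltjes integral $\int_0^t f\,dg=(-1)^\alpha\int_0^t D^\alpha_{0+}f(s)\,D^{1-\alpha}_{t-}g_{t-}(s)\,ds$, where $D^\alpha_{0+}f(s)=\frac1{\Gamma(1-\alpha)}\Big(\frac{f(s)}{s^\alpha}+\alpha\int_0^s\frac{f(s)-f(u)}{(s-u)^{\alpha+1}}du\Big)$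 and the unimodular factors are read as $(-1)^\alpha(-1)^{1-\alpha}=-1$. Matrices carry the operator norm. **Hypotheses.** For $r>0$, $\delta\in(0,1]$, consider: * **(H1)** $\sigma:[0,T]\times\mathbb R^d\to\mathbb R^{d\times m}$ is measurable, differentiable in $x$, and for all $x,y\in\mathbb R^d$, $s,t\in[0,T]$, $i=1,\dots,d$: $|\sigma(t,x)-\sigma(t,y)|\le M_0|x-y|$; $|\sigma(t,x)-\sigma(s,x)|+|\partial_{x_i}\sigma(t,x)-\partial_{x_i}\sigma(s,x)|\le M_0|t-s|^\beta$; and for every $N\ge0$ there is $M_N>0$ with $|\partial_{x_i}\sigma(t,x)-\partial_{x_i}\sigma(t,y)|\le M_N|x-y|^\delta$ whenever $|x|,|y|\le N$. * **(H2)** $b:[0,T]\times C(-r,T;\mathbb R^d)\to\mathbb R^d$ is measurable; for $t>0$, $b(t,f)$ depends only on $f|_{[-r,t]}$; for every $N\ge0$ there is $L_N>0$ with $|b(t,f)-b(t,h)|\le L_N\sup_{-r\le s\le t}|f(s)-h(s)|$ for all $t\in[0,T]$ and $\|f\|_{\infty(r)},\|h\|_{\infty(r)}\le N$; and there is $b_0\in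 L^{1/\alpha}(0,T;\mathbb R)$ with $\|b_0\|_{L^{1/\alpha}}\le B$ and $|b(t,f)|\le L_0\sup_{-r\le s\le t}|f(s)|+b_0(t)$ for all $t\in[0,T]$ and $f\in C(-r,T;\mathbb R^d)$. * **(H3)** $|\sigma(t,x)|\le K_0(1+|x|^\gamma)$ for all $x\in\mathbb R^d$, $t\in[0,T]$. **Claim.** There are constants $d^{(6)},d^{(7)},d^{(8)}>0$, depending only on $d,m,T,\alpha,\beta,\gamma,\varphi,M_0,K_0,L_0,B$, such that for all $r>0$ and $\delta\in(0,1]$, all $\sigma,b$ satisfying (H1), (H2), (H3), all $g\in W_T^{1-\alpha,\infty}(0,T;\mathbb R^m)$ and all $\eta\in W_0^{\alpha,\infty}(-r,0;\mathbb R^d)\cap C^{1-\alpha}(-r,0;\mathbb R^d)$, every continuous $x\in W_0^{\alpha,\infty}(-r,T;\mathbb R^d)$ that solves $$x(t)=\eta(0)+\int_0^t b(s,x)\,ds+\int_0^t\sigma(s,x(s-r))\,dg_s\quad(0<t\le T),\qquad x(t)=\eta(t)\quad(-r\le t\le0),$$ satisfies $$\|x\|_{\alpha,\infty(r)}\le d^{(6)}\big(\|\eta\|_{\alpha,\infty(-r,0)}+\Lambda_\alpha(g)+1\big)\exp\!\Big(d^{(7)}+d^{(8)}\Lambda_\alpha(g)^{\frac1{1-\varphi(\gamma,\alpha)}}\Big).$$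 -/

import Mathlib

open MeasureTheory Set Filter Topology
open scoped ENNReal NNReal

namespace DelayEq

noncomputable section

/-- Euclidean space `ℝⁿ`. -/
abbrev Vec (n : ℕ) : Type := EuclideanSpace ℝ (Fin n)

/-- Real `d × m` matrices, as linear maps `ℝᵐ → ℝᵈ` with the operator norm. -/
abbrev Mat (d m : ℕ) : Type := Vec m →L[ℝ] Vec d

/-- The norm `sup_{t ∈ [a,b]} ( |f(t)| + ∫_a^t |f(t) - f(s)| / (t-s)^{α+1} ds )`, with value in
`[0,∞]`. -/
def wNorm {E : Type*} [NormedAddCommGroup E] (α a b : ℝ) (f : ℝ → E) : ℝ≥0∞ :=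
  ⨆ t ∈ Icc a b,
    (‖f t‖ₑ + ∫⁻ s in Ioo a t, ENNReal.ofReal (‖f t - f s‖ / (t - s) ^ (α + 1)))

/-- The space `W_0^{α,∞}(a,b;E)`: measurable functions on `[a,b]` with finite norm. Only the
values on `[a,b]` matter. -/
def MemW {E : Type*} [NormedAddCommGroup E] [MeasurableSpace E] (α a b : ℝ) (f : ℝ → E) : Prop :=
  Measurable ((Icc a b).domRestrict f) ∧ wNorm α a b f < ∞

/-- The space `C^ν(a,b;E)` of `ν`-Hölder continuous functions on `[a,b]`. -/
def MemHolder {E : Type*} [NormedAddCommGroup E] (ν a b : ℝ) (f : ℝ → E) : Prop :=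
  ContinuousOn f (Icc a b) ∧
    ∃ C : ℝ, ∀ s ∈ Icc a b, ∀ t ∈ Icc a b, s < t → ‖f t - f s‖ ≤ C * (t - s) ^ ν

/-- The norm `sup_{0<s<t<T} ( |g(t)-g(s)| / (t-s)^{1-α} + ∫_s^t |g(u)-g(s)| / (u-s)^{2-α} du )` of
`W_T^{1-α,∞}(0,T;E)`, with value in `[0,∞]`. -/
def drvNorm {E : Type*} [NormedAddCommGroup E] (α T : ℝ) (g : ℝ → E) : ℝ≥0∞ :=
  ⨆ t ∈ Ioo 0 T, ⨆ s ∈ Ioo 0 t,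
    (ENNReal.ofReal (‖g t - g s‖ / (t - s) ^ (1 - α)) +
      ∫⁻ u in Ioo s t, ENNReal.ofReal (‖g u - g s‖ / (u - s) ^ (2 - α)))

/-- The space `W_T^{1-α,∞}(0,T;E)` of drivers. -/
def MemDrv {E : Type*} [NormedAddCommGroup E] [MeasurableSpace E] (α T : ℝ) (g : ℝ → E) : Prop :=
  Measurable ((Icc 0 T).domRestrict g) ∧ drvNorm α T g < ∞

/-- The left-sided Weyl derivative of order `α`,
`(D_{0+}^α f)(s) = Γ(1-α)⁻¹ ( f(s)/s^α + α ∫_0^s (f(s)-f(u)) / (s-u)^{α+1} du )`. -/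
def weylLeft {E : Type*} [NormedAddCommGroup E] [NormedSpace ℝ E]
    (α : ℝ) (f : ℝ → E) (s : ℝ) : E :=
  (Real.Gamma (1 - α))⁻¹ •
    ((s ^ α)⁻¹ • f s + α • ∫ u in Ioo 0 s, ((s - u) ^ (α + 1))⁻¹ • (f s - f u))

/-- The right-sided Weyl derivative of order `1-α` of `g_{t-} = g - g(t-)`, multiplied by the
unimodular constant `(-1)^α` (so that the result is real):
`(-1)^α (D_{t-}^{1-α} g_{t-})(s)
  = Γ(α)⁻¹ ( (g(t-)-g(s)) / (t-s)^{1-α} + (1-α) ∫_s^t (g(u)-g(s)) / (u-s)^{2-α} du )`. -/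
def weylRight {E : Type*} [NormedAddCommGroup E] [NormedSpace ℝ E]
    (α : ℝ) (g : ℝ → E) (t s : ℝ) : E :=
  (Real.Gamma α)⁻¹ •
    (((t - s) ^ (1 - α))⁻¹ • (Function.leftLim g t - g s) +
      (1 - α) • ∫ u in Ioo s t, ((u - s) ^ (2 - α))⁻¹ • (g u - g s))

/-- `Λ_α(g) = Γ(1-α)⁻¹ sup_{0<s<t<T} |(D_{t-}^{1-α} g_{t-})(s)|`. -/
def Lam {E : Type*} [NormedAddCommGroup E] [NormedSpace ℝ E]
    (α T : ℝ) (g : ℝ → E) : ℝ :=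
  (Real.Gamma (1 - α))⁻¹ * (⨆ t ∈ Ioo 0 T, ⨆ s ∈ Ioo 0 t, ‖weylRight α g t s‖ₑ).toReal

/-- The generalized Stieltjes integral
`∫_0^t f dg = (-1)^α ∫_0^t (D_{0+}^α f)(s) (D_{t-}^{1-α} g_{t-})(s) ds`. -/
def stieltjes {d m : ℕ} (α : ℝ) (f : ℝ → Mat d m) (g : ℝ → Vec m) (t : ℝ) : Vec d :=
  ∫ s in Ioo 0 t, (weylLeft α f s) (weylRight α g t s)

/-- Hypothesis (H1), with its global constant `M₀` displayed. -/
structure H1 {d m : ℕ} (T β δ M₀ : ℝ) (σ : ℝ → Vec d → Mat d m) : Prop where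
  beta_pos : 0 < β
  beta_le : β ≤ 1
  delta_pos : 0 < δ
  delta_le : δ ≤ 1
  const_pos : 0 < M₀
  meas : Measurable fun p : Icc (0 : ℝ) T × Vec d => σ p.1 p.2
  diff : ∀ t ∈ Icc 0 T, Differentiable ℝ (σ t)
  lip : ∀ t ∈ Icc 0 T, ∀ x y, ‖σ t x - σ t y‖ ≤ M₀ * ‖x - y‖
  deriv_holder : ∀ N : ℝ, 0 ≤ N → ∃ M > 0, ∀ t ∈ Icc 0 T, ∀ x y : Vec d,
    ‖x‖ ≤ N → ‖y‖ ≤ N → ∀ i : Fin d,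
      ‖fderiv ℝ (σ t) x (EuclideanSpace.single i 1)
        - fderiv ℝ (σ t) y (EuclideanSpace.single i 1)‖ ≤ M * ‖x - y‖ ^ δ
  time_holder : ∀ t ∈ Icc 0 T, ∀ s ∈ Icc 0 T, ∀ x : Vec d, ∀ i : Fin d,
    ‖σ t x - σ s x‖ +
      ‖fderiv ℝ (σ t) x (EuclideanSpace.single i 1)
        - fderiv ℝ (σ s) x (EuclideanSpace.single i 1)‖ ≤ M₀ * |t - s| ^ β

/-- `sup_{a ≤ s ≤ t} |f(s)|` for a continuous path `f` on `[a,b]`. -/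
def supUpTo {d : ℕ} {a b : ℝ} (f : C(Icc a b, Vec d)) (t : ℝ) : ℝ :=
  sSup ((fun s : Icc a b => ‖f s‖) '' {s | (s : ℝ) ≤ t})

/-- Hypothesis (H2) on the hereditary drift `b : [0,T] × C(-r,T;ℝᵈ) → ℝᵈ`, with the linear growth
constant `L₀`, the function `b₀` and its integrability exponent `ρ` displayed. The norm on
`C(-r,T;ℝᵈ)` is the sup norm. -/
structure H2 {d : ℕ} (r T ρ L₀ : ℝ) (b₀ : ℝ → ℝ) (b : ℝ → C(Icc (-r) T, Vec d) → Vec d) :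
    Prop where
  rho_ge : 2 ≤ ρ
  const_pos : 0 < L₀
  memLp : MemLp b₀ (ENNReal.ofReal ρ) (volume.restrict (Icc 0 T))
  meas : @Measurable (Icc (0 : ℝ) T × C(Icc (-r) T, Vec d)) (Vec d)
    (@Prod.instMeasurableSpace _ _ _ (borel _)) _ fun p => b p.1 p.2
  nonanticipative : ∀ t ∈ Ioc 0 T, ∀ f h : C(Icc (-r) T, Vec d),
    (∀ s : Icc (-r) T, (s : ℝ) ≤ t → f s = h s) → b t f = b t h
  lip : ∀ N : ℝ, 0 ≤ N → ∃ L > 0, ∀ f h : C(Icc (-r) T, Vec d), ‖f‖ ≤ N → ‖h‖ ≤ N →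
    ∀ t ∈ Icc 0 T, ‖b t f - b t h‖ ≤ L * supUpTo (f - h) t
  growth : ∀ f : C(Icc (-r) T, Vec d), ∀ t ∈ Icc 0 T, ‖b t f‖ ≤ L₀ * supUpTo f t + b₀ t

/-- Hypothesis (H3), with its exponent and its constant displayed. -/
structure H3 {d m : ℕ} (T γ K₀ : ℝ) (σ : ℝ → Vec d → Mat d m) : Prop where
  gamma_nonneg : 0 ≤ γ
  gamma_le : γ ≤ 1
  const_pos : 0 < K₀
  growth : ∀ t ∈ Icc 0 T, ∀ x, ‖σ t x‖ ≤ K₀ * (1 + ‖x‖ ^ γ)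

/-- `p` is an admissible value of the exponent `φ(γ,α)`. -/
def IsPhi (γ α p : ℝ) : Prop :=
  (γ = 1 → p = 2 * α) ∧
  ((1 - 2 * α) / (1 - α) ≤ γ → γ < 1 → 1 + (2 * α - 1) / γ < p ∧ p ≤ 2 * α) ∧
  (γ < (1 - 2 * α) / (1 - α) → p = α)

/-- `x ∈ W_0^{α,∞}(-r,T;ℝᵈ) ∩ C(-r,T;ℝᵈ)` solves
`x(t) = η(0) + ∫_0^t b(s,x) ds + ∫_0^t σ(s,x(s-r)) dg_s` for `t ∈ (0,T]`, and
`x(t) = η(t)` for `t ∈ [-r,0]`. -/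
structure IsSolution {d m : ℕ} (α r T : ℝ) (b : ℝ → C(Icc (-r) T, Vec d) → Vec d)
    (σ : ℝ → Vec d → Mat d m) (g : ℝ → Vec m) (η x : ℝ → Vec d) : Prop where
  memW : MemW α (-r) T x
  cont : ContinuousOn x (Icc (-r) T)
  eqn : ∀ t ∈ Ioc 0 T,
    x t = η 0 + (∫ s in Ioo 0 t, b s ⟨(Icc (-r) T).domRestrict x, cont.domRestrict⟩)
      + stieltjes α (fun s => σ s (x (s - r))) g t
  init : ∀ t ∈ Icc (-r) 0, x t = η t

end

end DelayEq

namespace DelayEq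

/-! The proof is an a priori estimate in an exponentially weighted norm. Suppose `pathNorm` of x at
u is at most N e^{c max(u,0)} on [-r,T]. Inserting this into the equation returns a bound of the
same form, in which N is multiplied by E₂ c^{-α} + E₃ Λ c^{φ-1} (`exists_pathNorm_step`). If c is a
constant plus a constant times Λ^{1/(1-φ)}, this factor is at most 1/2, so N improves to A + N/2
with A = ‖η‖ + E₀ + E₁Λ. The norm of x is finite to begin with, so iteration yields 2A e^{c
max(t,0)} (`pathNorm_le_of_contraction`). The delay costs nothing: the weight at u - r is at most
the weight at u, and no constant involves r.

The negative powers of c come from integrating e^{cu} against a singular kernel q^{-p}, with q = u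
or q = t-u, which gives a multiple of c^{p-1} e^{ct}. The drift gives c^{-α} once a factor
(t-s)^{1-α} is extracted. For the diffusion term, its size and its fractional increments are both
bounded by Λ times the single convolution `majorantConv` (`lintegral_stieltjes_sub_le`). There the
growth of σ meets a singularity q^{-2α}; Young's inequality (`IsPhi.exists_young`) trades q^{-2α}
X^γ for q^{-φ} X plus an integrable error, and `exists_majorantConv_le` extracts c^{φ-1}.

The upper limit t also enters the Stieltjes integrand, through g_{t-}. Increments therefore require
comparing right-sided Weyl derivatives with different upper limits (`norm_weylRight_sub_le`), with
constants depending on Λ alone. For this the Hölder constant of g is recovered from its Weyl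
derivatives by a differential inequality (`norm_integral_kernel_le_of_weylRight`). -/

/-! ### Integrals of power kernels. -/

lemma intervalIntegrable_sub_rpow_left {a b p : ℝ} (hp : p < 1) :
    IntervalIntegrable (fun u => (u - a) ^ (-p)) volume a b := by
  have h := (intervalIntegral.intervalIntegrable_rpow' (a := 0) (b := b - a)
    (r := -p) (by linarith)).comp_sub_right a
  simpa using h

lemma intervalIntegrable_sub_rpow_right {a b p : ℝ} (hp : p < 1) :
    IntervalIntegrable (fun u => (b - u) ^ (-p)) volume a b := by
  have h := (intervalIntegral.intervalIntegrable_rpow' (a := b - a) (b := 0)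
    (r := -p) (by linarith)).comp_sub_left b
  simpa using h

lemma lintegral_Ioo_eq_ofReal_intervalIntegral {a b : ℝ} (hab : a ≤ b) {f : ℝ → ℝ}
    (hf : IntervalIntegrable f volume a b) (h0 : ∀ u ∈ Ioo a b, 0 ≤ f u) :
    ∫⁻ u in Ioo a b, ENNReal.ofReal (f u) = ENNReal.ofReal (∫ u in a..b, f u) := by
  rw [intervalIntegral.integral_of_le hab, integral_Ioc_eq_integral_Ioo]
  rw [ofReal_integral_eq_lintegral_ofReal]
  · exact ((intervalIntegrable_iff_integrableOn_Ioo_of_le hab).1 hf)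
  · exact (ae_restrict_iff' measurableSet_Ioo).2 (ae_of_all _ h0)

lemma lintegral_sub_rpow_left {a b p : ℝ} (hab : a ≤ b) (hp : p < 1) :
    ∫⁻ u in Ioo a b, ENNReal.ofReal ((u - a) ^ (-p))
      = ENNReal.ofReal ((b - a) ^ (1 - p) / (1 - p)) := by
  rw [lintegral_Ioo_eq_ofReal_intervalIntegral hab (intervalIntegrable_sub_rpow_left hp)
    (fun u hu => Real.rpow_nonneg (by linarith [hu.1]) _)]
  rw [intervalIntegral.integral_comp_sub_right (fun u => u ^ (-p)) a, sub_self,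
    integral_rpow (Or.inl (by linarith)), Real.zero_rpow (by linarith)]
  congr 1
  rw [sub_zero, show -p + 1 = 1 - p by ring]

lemma lintegral_sub_rpow_right {a b p : ℝ} (hab : a ≤ b) (hp : p < 1) :
    ∫⁻ u in Ioo a b, ENNReal.ofReal ((b - u) ^ (-p))
      = ENNReal.ofReal ((b - a) ^ (1 - p) / (1 - p)) := by
  rw [lintegral_Ioo_eq_ofReal_intervalIntegral hab (intervalIntegrable_sub_rpow_right hp)
    (fun u hu => Real.rpow_nonneg (by linarith [hu.2]) _)]
  rw [intervalIntegral.integral_comp_sub_left (fun u => u ^ (-p)) b, sub_self,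
    integral_rpow (Or.inl (by linarith)), Real.zero_rpow (by linarith)]
  congr 1
  rw [sub_zero, show -p + 1 = 1 - p by ring]

lemma lintegral_const_mul_ofReal {c : ℝ} (hc : 0 ≤ c) {f : ℝ → ℝ} (hf : Measurable f)
    (s : Set ℝ) :
    ∫⁻ u in s, ENNReal.ofReal (c * f u)
      = ENNReal.ofReal c * ∫⁻ u in s, ENNReal.ofReal (f u) := by
  simp_rw [ENNReal.ofReal_mul hc]
  exact lintegral_const_mul _ hf.ennreal_ofReal

/-- The integral of a kernel that is singular at an endpoint lying outside the domain. -/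
lemma lintegral_sub_rpow_neg_one_sub {a u t α : ℝ} (hα : 0 < α) (hau : a ≤ u) (hut : u < t) :
    ∫⁻ s in Ioo a u, ENNReal.ofReal ((t - s) ^ (-α - 1))
      ≤ ENNReal.ofReal ((t - u) ^ (-α) / α) := by
  have h0 : (0 : ℝ) ∉ uIcc (t - u) (t - a) := by
    rw [uIcc_of_le (by linarith)]
    intro h
    linarith [h.1]
  have hi : IntervalIntegrable (fun s => (t - s) ^ (-α - 1)) volume a u := by
    have h := (intervalIntegral.intervalIntegrable_rpow (μ := volume) (a := t - a) (b := t - u)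
      (r := -α - 1) (Or.inr (by rwa [uIcc_comm]))).comp_sub_left t
    simpa using h
  rw [lintegral_Ioo_eq_ofReal_intervalIntegral hau hi
    (fun s hs => Real.rpow_nonneg (by linarith [hs.2]) _)]
  apply ENNReal.ofReal_le_ofReal
  rw [intervalIntegral.integral_comp_sub_left (fun u => u ^ (-α - 1)) t,
    integral_rpow (Or.inr ⟨by linarith, h0⟩), show -α - 1 + 1 = -α by ring, div_neg, ← neg_div]
  have : 0 ≤ (t - a) ^ (-α) := Real.rpow_nonneg (by linarith) _
  gcongr
  linarith

/-- The larger of a and b is at least their mean, so its negative power may be replaced by that of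
the mean. This splits a Beta integrand into two terms with one singularity each. -/
lemma rpow_neg_mul_rpow_neg_le {a b p q : ℝ} (ha : 0 < a) (hb : 0 < b) (hp : 0 ≤ p)
    (hq : 0 ≤ q) :
    a ^ (-p) * b ^ (-q)
      ≤ ((a + b) / 2) ^ (-p) * b ^ (-q) + ((a + b) / 2) ^ (-q) * a ^ (-p) := by
  have h1 : 0 < a ^ (-p) := Real.rpow_pos_of_pos ha _
  have h2 : 0 < b ^ (-q) := Real.rpow_pos_of_pos hb _
  have h3 : 0 < ((a + b) / 2) ^ (-p) := Real.rpow_pos_of_pos (by linarith) _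
  have h4 : 0 < ((a + b) / 2) ^ (-q) := Real.rpow_pos_of_pos (by linarith) _
  rcases le_total a b with h | h
  · have : b ^ (-q) ≤ ((a + b) / 2) ^ (-q) :=
      Real.rpow_le_rpow_of_nonpos (by linarith) (by linarith) (by linarith)
    nlinarith [mul_pos h3 h2]
  · have : a ^ (-p) ≤ ((a + b) / 2) ^ (-p) :=
      Real.rpow_le_rpow_of_nonpos (by linarith) (by linarith) (by linarith)
    nlinarith [mul_pos h4 h1]

/-- A bound for the Beta-type integral of `(t-s)^(-p) (s-u)^(-q)`. -/
lemma lintegral_beta_le {u t p q : ℝ} (hut : u < t) (hp : 0 ≤ p) (hp1 : p < 1) (hq : 0 ≤ q)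
    (hq1 : q < 1) :
    ∫⁻ s in Ioo u t, ENNReal.ofReal ((t - s) ^ (-p) * (s - u) ^ (-q))
      ≤ ENNReal.ofReal ((2 ^ p / (1 - q) + 2 ^ q / (1 - p)) * (t - u) ^ (1 - p - q)) := by
  have hl : 0 < t - u := by linarith
  have e1 : 0 ≤ ((t - u) / 2) ^ (-p) := by positivity
  have e2 : 0 ≤ ((t - u) / 2) ^ (-q) := by positivity
  calc ∫⁻ s in Ioo u t, ENNReal.ofReal ((t - s) ^ (-p) * (s - u) ^ (-q))
      ≤ ∫⁻ s in Ioo u t, (ENNReal.ofReal (((t - u) / 2) ^ (-p) * (s - u) ^ (-q)) +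
          ENNReal.ofReal (((t - u) / 2) ^ (-q) * (t - s) ^ (-p))) := by
        refine setLIntegral_mono' measurableSet_Ioo fun s hs => ?_
        have h1 : 0 < t - s := by linarith [hs.2]
        have h2 : 0 < s - u := by linarith [hs.1]
        rw [← ENNReal.ofReal_add (by positivity) (by positivity)]
        apply ENNReal.ofReal_le_ofReal
        have := rpow_neg_mul_rpow_neg_le h1 h2 hp hq
        rwa [show t - s + (s - u) = t - u by ring] at this
    _ = ENNReal.ofReal (((t - u) / 2) ^ (-p) * ((t - u) ^ (1 - q) / (1 - q))) +
          ENNReal.ofReal (((t - u) / 2) ^ (-q) * ((t - u) ^ (1 - p) / (1 - p))) := by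
        rw [lintegral_add_left (by fun_prop), lintegral_const_mul_ofReal e1 (by fun_prop),
          lintegral_const_mul_ofReal e2 (by fun_prop), lintegral_sub_rpow_left hut.le hq1,
          lintegral_sub_rpow_right hut.le hp1, ENNReal.ofReal_mul e1, ENNReal.ofReal_mul e2]
    _ = _ := by
        have h1 : 0 < 1 - q := by linarith
        have h2 : 0 < 1 - p := by linarith
        rw [← ENNReal.ofReal_add (by positivity) (by positivity)]
        congr 1
        rw [Real.div_rpow hl.le (by norm_num), Real.div_rpow hl.le (by norm_num),
          Real.rpow_neg (by norm_num : (0:ℝ) ≤ 2), Real.rpow_neg (by norm_num : (0:ℝ) ≤ 2),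
          show 1 - p - q = -p + (1 - q) by ring, Real.rpow_add hl]
        have : (t - u) ^ (-q) * (t - u) ^ (1 - p) = (t - u) ^ (-p) * (t - u) ^ (1 - q) := by
          rw [← Real.rpow_add hl, ← Real.rpow_add hl]; congr 1; ring
        field_simp
        linear_combination (2 ^ q * (1 - q)) * this

/-! ### Exponential weights against singular kernels. -/

lemma integral_exp_mul (c : ℝ) (hc : c ≠ 0) (a b : ℝ) :
    ∫ u in a..b, Real.exp (c * u) = (Real.exp (c * b) - Real.exp (c * a)) / c := by
  rw [intervalIntegral.integral_comp_mul_left (fun u => Real.exp u) hc, integral_exp,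
    smul_eq_mul]
  ring

lemma one_sub_exp_neg_le_rpow {z θ : ℝ} (hz : 0 ≤ z) (h0 : 0 ≤ θ) (h1 : θ ≤ 1) :
    1 - Real.exp (-z) ≤ z ^ θ := by
  rcases le_total z 1 with h | h
  · have := Real.add_one_le_exp (-z)
    rcases hz.eq_or_lt with rfl | hz
    · simp; exact Real.rpow_nonneg le_rfl _
    have h2 : z ^ (1 : ℝ) ≤ z ^ θ := Real.rpow_le_rpow_of_exponent_ge hz h h1
    rw [Real.rpow_one] at h2
    linarith
  · have := Real.exp_pos (-z)
    have := Real.one_le_rpow h h0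
    linarith

/-- Interpolates between the bounds 1/c and b - a for the mass of the weight near b. The choice θ =
1-α gives the drift its Hölder exponent and the factor c^{-α}. -/
lemma integral_exp_mul_le {c a b θ : ℝ} (hc : 0 < c) (hab : a ≤ b) (h0 : 0 ≤ θ) (h1 : θ ≤ 1) :
    ∫ u in a..b, Real.exp (c * u) ≤ Real.exp (c * b) * ((b - a) ^ θ * c ^ (θ - 1)) := by
  rw [integral_exp_mul c hc.ne']
  have h := one_sub_exp_neg_le_rpow (z := c * (b - a)) (by nlinarith) h0 h1
  rw [Real.mul_rpow hc.le (by linarith)] at h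
  have e : Real.exp (c * a) = Real.exp (c * b) * Real.exp (-(c * (b - a))) := by
    rw [← Real.exp_add]; congr 1; ring
  rw [e, Real.rpow_sub_one hc.ne', div_le_iff₀ hc]
  have := mul_le_mul_of_nonneg_left h (Real.exp_pos (c * b)).le
  calc _ = Real.exp (c * b) * (1 - Real.exp (-(c * (b - a)))) := by ring
    _ ≤ _ := this
    _ = _ := by field_simp

lemma lintegral_exp_mul_le {c a b : ℝ} (hc : 0 < c) (hab : a ≤ b) :
    ∫⁻ u in Ioo a b, ENNReal.ofReal (Real.exp (c * u))
      ≤ ENNReal.ofReal (Real.exp (c * b) * c⁻¹) := by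
  rw [lintegral_Ioo_eq_ofReal_intervalIntegral hab
    ((by fun_prop : Continuous fun u => Real.exp (c * u)).intervalIntegrable _ _)
    (fun u _ => (Real.exp_pos _).le)]
  apply ENNReal.ofReal_le_ofReal
  have := integral_exp_mul_le hc hab le_rfl zero_le_one
  simpa [Real.rpow_neg_one] using this

/-- Cut at q = 1/c. Below the cut the exponential is at most e^{ct} and `hS` gives the mass of the
singularity; above it q^{-p} ≤ c^p and the exponential integrates to at most e^{ct}/c. Both parts
are of order c^{p-1} e^{ct}. -/
lemma lintegral_exp_mul_rpow_neg_aux {c p t : ℝ} (hc : 0 < c) (hp : 0 ≤ p) (hp1 : p < 1)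
    (ht : 0 ≤ t) {q : ℝ → ℝ} (hq : Measurable q) (hq0 : ∀ u ∈ Ioo 0 t, 0 < q u)
    (hS : ∫⁻ u in {u | 0 < q u ∧ q u < 1 / c}, ENNReal.ofReal (q u ^ (-p))
      ≤ ENNReal.ofReal ((1 / c) ^ (1 - p) / (1 - p))) :
    ∫⁻ u in Ioo 0 t, ENNReal.ofReal (Real.exp (c * u) * q u ^ (-p))
      ≤ ENNReal.ofReal ((1 + 1 / (1 - p)) * c ^ (p - 1) * Real.exp (c * t)) := by
  set S := {u | 0 < q u ∧ q u < 1 / c} with hSdef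
  have hSm : MeasurableSet S :=
    (measurableSet_lt measurable_const hq).inter (measurableSet_lt hq measurable_const)
  have e1 : 0 ≤ Real.exp (c * t) := (Real.exp_pos _).le
  have e2 : 0 ≤ c ^ p := Real.rpow_nonneg hc.le _
  have e3 : 0 < 1 - p := by linarith
  calc ∫⁻ u in Ioo 0 t, ENNReal.ofReal (Real.exp (c * u) * q u ^ (-p))
      ≤ ∫⁻ u in Ioo 0 t, (S.indicator (fun u => ENNReal.ofReal (Real.exp (c * t) * q u ^ (-p))) u
          + ENNReal.ofReal (c ^ p * Real.exp (c * u))) := by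
        refine setLIntegral_mono' measurableSet_Ioo fun u hu => ?_
        by_cases h : q u < 1 / c
        · rw [indicator_of_mem (show u ∈ S from ⟨hq0 u hu, h⟩)]
          refine le_add_right (ENNReal.ofReal_le_ofReal ?_)
          have := hq0 u hu
          have : c * u ≤ c * t := by nlinarith [hu.2]
          gcongr
        · refine le_add_left (ENNReal.ofReal_le_ofReal ?_)
          have : q u ^ (-p) ≤ (1 / c) ^ (-p) :=
            Real.rpow_le_rpow_of_nonpos (by positivity) (not_lt.1 h) (by linarith)
          rw [one_div, Real.inv_rpow hc.le, Real.rpow_neg hc.le, inv_inv] at this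
          rw [mul_comm]
          gcongr
    _ ≤ ENNReal.ofReal (Real.exp (c * t) * ((1 / c) ^ (1 - p) / (1 - p))) +
          ENNReal.ofReal (c ^ p * (Real.exp (c * t) * c⁻¹)) := by
        rw [lintegral_add_right _ (by fun_prop)]
        refine add_le_add ?_ ?_
        · refine (setLIntegral_le_lintegral _ _).trans ?_
          rw [lintegral_indicator hSm, lintegral_const_mul_ofReal e1 (by fun_prop),
            ENNReal.ofReal_mul e1]
          gcongr
        · rw [lintegral_const_mul_ofReal e2 (by fun_prop), ENNReal.ofReal_mul e2]
          gcongr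
          exact lintegral_exp_mul_le hc ht
    _ = _ := by
        rw [← ENNReal.ofReal_add (by positivity) (by positivity)]
        congr 1
        rw [one_div c, Real.inv_rpow hc.le, ← Real.rpow_neg hc.le,
          show -(1 - p) = p - 1 by ring, Real.rpow_sub_one hc.ne']
        field_simp
        ring

lemma lintegral_exp_mul_rpow_neg_left {c p t : ℝ} (hc : 0 < c) (hp : 0 ≤ p) (hp1 : p < 1)
    (ht : 0 ≤ t) :
    ∫⁻ u in Ioo 0 t, ENNReal.ofReal (Real.exp (c * u) * u ^ (-p))
      ≤ ENNReal.ofReal ((1 + 1 / (1 - p)) * c ^ (p - 1) * Real.exp (c * t)) := by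
  refine lintegral_exp_mul_rpow_neg_aux (q := fun u => u) hc hp hp1 ht measurable_id
    (fun u hu => hu.1) ?_
  have := lintegral_sub_rpow_left (a := 0) (b := 1 / c) (by positivity) hp1
  simp only [sub_zero] at this
  exact this.le

lemma lintegral_exp_mul_rpow_neg_right {c p t : ℝ} (hc : 0 < c) (hp : 0 ≤ p) (hp1 : p < 1)
    (ht : 0 ≤ t) :
    ∫⁻ u in Ioo 0 t, ENNReal.ofReal (Real.exp (c * u) * (t - u) ^ (-p))
      ≤ ENNReal.ofReal ((1 + 1 / (1 - p)) * c ^ (p - 1) * Real.exp (c * t)) := by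
  refine lintegral_exp_mul_rpow_neg_aux (q := fun u => t - u) hc hp hp1 ht (by fun_prop)
    (fun u hu => by linarith [hu.2]) ?_
  have := lintegral_sub_rpow_right (a := t - 1 / c) (b := t) (by simp [hc.le]) hp1
  rw [sub_sub_cancel] at this
  rw [← this]
  have hS : {u | 0 < t - u ∧ t - u < 1 / c} = Ioo (t - 1 / c) t := by
    ext u
    simp only [mem_ofPred_eq, mem_Ioo]
    constructor <;> rintro ⟨h1, h2⟩ <;> constructor <;> linarith
  rw [hS]

/-! ### Control of the driver by its Weyl derivatives. -/

section Driver

variable {E : Type*} [NormedAddCommGroup E]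

/-- The two pointwise bounds that make up finiteness of `drvNorm`. -/
structure DriverBound (α T D : ℝ) (g : ℝ → E) : Prop where
  nonneg : 0 ≤ D
  holder : ∀ t ∈ Ioo 0 T, ∀ s ∈ Ioo 0 t, ‖g t - g s‖ ≤ D * (t - s) ^ (1 - α)
  lint : ∀ t ∈ Ioo 0 T, ∀ s ∈ Ioo 0 t,
    ∫⁻ u in Ioo s t, ENNReal.ofReal (‖g u - g s‖ / (u - s) ^ (2 - α)) ≤ ENNReal.ofReal D

lemma driverBound_of_drvNorm_lt_top {α T : ℝ} {g : ℝ → E} (h : drvNorm α T g < ∞) :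
    DriverBound α T (drvNorm α T g).toReal g := by
  have key : ∀ t ∈ Ioo 0 T, ∀ s ∈ Ioo 0 t,
      ENNReal.ofReal (‖g t - g s‖ / (t - s) ^ (1 - α)) +
      ∫⁻ u in Ioo s t, ENNReal.ofReal (‖g u - g s‖ / (u - s) ^ (2 - α))
        ≤ ENNReal.ofReal (drvNorm α T g).toReal := by
    intro t ht s hs
    rw [ENNReal.ofReal_toReal h.ne]
    exact le_iSup₂_of_le t ht (le_iSup₂_of_le s hs le_rfl)
  refine ⟨ENNReal.toReal_nonneg, fun t ht s hs => ?_, fun t ht s hs =>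
    le_add_self.trans (key t ht s hs)⟩
  have h1 := le_self_add.trans (key t ht s hs)
  rw [ENNReal.ofReal_le_ofReal_iff ENNReal.toReal_nonneg, div_le_iff₀] at h1
  · exact h1
  · exact Real.rpow_pos_of_pos (by linarith [hs.2]) _

namespace DriverBound

variable {α T D : ℝ} {g : ℝ → E}

lemma holderOnWith (hg : DriverBound α T D g) (hα1 : α < 1) :
    HolderOnWith D.toNNReal (1 - α).toNNReal g (Ioo 0 T) := by
  have key : ∀ x ∈ Ioo 0 T, ∀ y ∈ Ioo 0 T, x ≤ y →
      dist (g x) (g y) ≤ D * dist x y ^ (1 - α) := by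
    intro x hx y hy hxy
    rcases hxy.eq_or_lt with rfl | hxy
    · rw [dist_self, dist_self]
      exact mul_nonneg hg.nonneg (Real.rpow_nonneg le_rfl _)
    · rw [dist_comm, dist_comm x, dist_eq_norm, Real.dist_eq, abs_of_pos (by linarith)]
      exact hg.holder y hy x ⟨hx.1, hxy⟩
  intro x hx y hy
  rw [edist_dist, edist_dist, Real.coe_toNNReal _ (by linarith),
    ENNReal.ofReal_rpow_of_nonneg dist_nonneg (by linarith),
    ← ENNReal.ofReal_coe_nnreal, Real.coe_toNNReal _ hg.nonneg, ← ENNReal.ofReal_mul hg.nonneg]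
  apply ENNReal.ofReal_le_ofReal
  rcases le_total x y with h | h
  · exact key x hx y hy h
  · rw [dist_comm, dist_comm x]
    exact key y hy x hx h

lemma uniformContinuousOn (hg : DriverBound α T D g) (hα1 : α < 1) :
    UniformContinuousOn g (Ioo 0 T) :=
  (hg.holderOnWith hα1).uniformContinuousOn (by simpa using hα1)

lemma continuousOn (hg : DriverBound α T D g) (hα1 : α < 1) : ContinuousOn g (Ioo 0 T) :=
  (hg.uniformContinuousOn hα1).continuousOn

lemma continuousAt (hg : DriverBound α T D g) (hα1 : α < 1) {t : ℝ} (ht : t ∈ Ioo 0 T) :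
    ContinuousAt g t :=
  (hg.continuousOn hα1).continuousAt (isOpen_Ioo.mem_nhds ht)

lemma leftLim_eq (hg : DriverBound α T D g) (hα1 : α < 1) {t : ℝ} (ht : t ∈ Ioo 0 T) :
    Function.leftLim g t = g t :=
  (hg.continuousAt hα1 ht).continuousWithinAt.leftLim_eq

/-- `drvNorm` sees only interior times, so g(T) itself is unconstrained; uniform continuity on the
open interval still provides g(T-). -/
lemma tendsto_leftLim [CompleteSpace E] (hg : DriverBound α T D g) (hα1 : α < 1) (hT : 0 < T) :
    Tendsto g (𝓝[<] T) (𝓝 (Function.leftLim g T)) := by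
  apply tendsto_leftLim_of_tendsto
  have hc : Cauchy (𝓝[<] T) := cauchy_nhds.mono inf_le_left
  refine CompleteSpace.complete (hc.map_of_le (hg.uniformContinuousOn hα1) ?_)
  rw [le_principal_iff]
  exact Ioo_mem_nhdsLT hT

/-- Monotone convergence along times increasing to t brings in the endpoint t = T. -/
lemma lint_le (hg : DriverBound α T D g) {t : ℝ} (ht : t ∈ Ioc 0 T) {s : ℝ} (hs : s ∈ Ioo 0 t) :
    ∫⁻ u in Ioo s t, ENNReal.ofReal (‖g u - g s‖ / (u - s) ^ (2 - α)) ≤ ENNReal.ofReal D := by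
  obtain ⟨v, hv, hvm, hvt⟩ := exists_seq_strictMono_tendsto' hs.2
  have hU : Ioo s t = ⋃ n, Ioo s (v n) := by
    ext u
    simp only [mem_iUnion, mem_Ioo, exists_and_left]
    refine and_congr_right fun _ => ⟨fun h => ?_, fun ⟨n, h⟩ => h.trans (hvm n).2⟩
    exact ((tendsto_order.1 hvt).1 u h).exists
  rw [hU, setLIntegral_iUnion_of_directed]
  · exact iSup_le fun n => hg.lint (v n)
      ⟨hs.1.trans (hvm n).1, (hvm n).2.trans_le ht.2⟩ s ⟨hs.1, (hvm n).1⟩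
  · exact (monotone_nat_of_le_succ fun n =>
      Ioo_subset_Ioo_right (hv.monotone n.le_succ)).directed_le

variable [NormedSpace ℝ E]

lemma continuousOn_kernel (hg : DriverBound α T D g) (hα1 : α < 1) {s : ℝ} (hs : 0 < s) :
    ContinuousOn (fun u => ((u - s) ^ (2 - α))⁻¹ • (g u - g s)) (Ioo s T) := by
  refine ContinuousOn.smul (ContinuousOn.inv₀ ?_ ?_) ?_
  · exact ContinuousOn.rpow_const (by fun_prop) fun u hu => Or.inl (by linarith [hu.1])
  · exact fun u hu => (Real.rpow_pos_of_pos (by linarith [hu.1]) _).ne'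
  · exact ((hg.continuousOn hα1).mono (Ioo_subset_Ioo_left hs.le)).sub continuousOn_const

lemma integrableOn_kernel (hg : DriverBound α T D g) (hα1 : α < 1) {t : ℝ} (ht : t ∈ Ioc 0 T)
    {s : ℝ} (hs : s ∈ Ioo 0 t) :
    IntegrableOn (fun u => ((u - s) ^ (2 - α))⁻¹ • (g u - g s)) (Ioo s t) := by
  refine ⟨((hg.continuousOn_kernel hα1 hs.1).mono
    (Ioo_subset_Ioo_right ht.2)).aestronglyMeasurable measurableSet_Ioo, ?_⟩
  refine lt_of_le_of_lt ?_ ((hg.lint_le ht hs).trans_lt ENNReal.ofReal_lt_top)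
  refine setLIntegral_mono' measurableSet_Ioo fun u hu => ?_
  rw [← ofReal_norm, norm_smul, norm_inv, div_eq_inv_mul, Real.norm_of_nonneg]
  exact Real.rpow_nonneg (by linarith [hu.1]) _

lemma intervalIntegrable_kernel (hg : DriverBound α T D g) (hα1 : α < 1) {t : ℝ}
    (ht : t ∈ Ioc 0 T) {s : ℝ} (hs : s ∈ Ioo 0 t) :
    IntervalIntegrable (fun u => ((u - s) ^ (2 - α))⁻¹ • (g u - g s)) volume s t :=
  (intervalIntegrable_iff_integrableOn_Ioo_of_le hs.2.le).2 (hg.integrableOn_kernel hα1 ht hs)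

lemma norm_integral_kernel_le (hg : DriverBound α T D g) {t : ℝ} (ht : t ∈ Ioc 0 T)
    {s : ℝ} (hs : s ∈ Ioo 0 t) :
    ‖∫ u in Ioo s t, ((u - s) ^ (2 - α))⁻¹ • (g u - g s)‖ ≤ D := by
  rw [← ENNReal.ofReal_le_ofReal_iff hg.nonneg, ofReal_norm]
  refine (enorm_integral_le_lintegral_enorm _).trans ((le_of_eq ?_).trans (hg.lint_le ht hs))
  refine setLIntegral_congr_fun measurableSet_Ioo fun u hu => ?_
  rw [← ofReal_norm, norm_smul, norm_inv, div_eq_inv_mul, Real.norm_of_nonneg]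
  exact Real.rpow_nonneg (by linarith [hu.1]) _

/-- Used only to see that the supremum inside `Lam` is finite, so that its `toReal` is a genuine
bound. -/
lemma norm_weylRight_le (hg : DriverBound α T D g) (hα : 0 < α) (hα1 : α < 1) {t : ℝ}
    (ht : t ∈ Ioo 0 T) {s : ℝ} (hs : s ∈ Ioo 0 t) :
    ‖weylRight α g t s‖ ≤ (Real.Gamma α)⁻¹ * (D + (1 - α) * D) := by
  have hG : 0 < Real.Gamma α := Real.Gamma_pos_of_pos hα
  have h0 : 0 < (t - s) ^ (1 - α) := Real.rpow_pos_of_pos (by linarith [hs.2]) _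
  rw [weylRight, hg.leftLim_eq hα1 ht, norm_smul, norm_inv, Real.norm_of_nonneg hG.le]
  gcongr
  refine (norm_add_le _ _).trans ?_
  gcongr
  · rw [norm_smul, norm_inv, Real.norm_of_nonneg h0.le, inv_mul_le_iff₀ h0, mul_comm]
    exact hg.holder t ht s hs
  · rw [norm_smul, Real.norm_of_nonneg (by linarith)]
    have := hg.norm_integral_kernel_le ⟨ht.1, ht.2.le⟩ hs
    have : 0 < 1 - α := by linarith
    gcongr

lemma tendsto_weylRight [CompleteSpace E] (hg : DriverBound α T D g) (hα1 : α < 1)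
    {s : ℝ} (hs : s ∈ Ioo 0 T) :
    Tendsto (fun t => weylRight α g t s) (𝓝[<] T) (𝓝 (weylRight α g T s)) := by
  have hT : 0 < T := hs.1.trans hs.2
  have hev : ∀ᶠ t in 𝓝[<] T, t ∈ Ioo s T := Ioo_mem_nhdsLT hs.2
  have hlim : Tendsto (fun t => Function.leftLim g t) (𝓝[<] T) (𝓝 (Function.leftLim g T)) := by
    refine (hg.tendsto_leftLim hα1 hT).congr' ?_
    filter_upwards [hev] with t ht
    exact (hg.leftLim_eq hα1 ⟨hs.1.trans ht.1, ht.2⟩).symm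
  have hint : Tendsto (fun t => ∫ u in Ioo s t, ((u - s) ^ (2 - α))⁻¹ • (g u - g s)) (𝓝[<] T)
      (𝓝 (∫ u in Ioo s T, ((u - s) ^ (2 - α))⁻¹ • (g u - g s))) := by
    have h1 : IntegrableOn (fun u => ((u - s) ^ (2 - α))⁻¹ • (g u - g s)) (Icc s T) :=
      (integrableOn_Icc_iff_integrableOn_Ioo (by simp) (by simp)).2
        (hg.integrableOn_kernel hα1 ⟨hT, le_rfl⟩ hs)
    have h2 := (intervalIntegral.continuousOn_primitive h1) T (right_mem_Icc.2 hs.2.le)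
    simp only [integral_Ioc_eq_integral_Ioo] at h2
    refine h2.tendsto.mono_left ?_
    rw [← nhdsWithin_Ioo_eq_nhdsLT hs.2]
    exact nhdsWithin_mono _ Ioo_subset_Icc_self
  have hpow : Tendsto (fun t => ((t - s) ^ (1 - α))⁻¹) (𝓝[<] T) (𝓝 ((T - s) ^ (1 - α))⁻¹) := by
    have hc : ContinuousAt (fun t => ((t - s) ^ (1 - α))⁻¹) T := by
      refine ContinuousAt.inv₀ ?_ (Real.rpow_pos_of_pos (by linarith [hs.2]) _).ne'
      exact ContinuousAt.rpow_const (by fun_prop) (Or.inl (by linarith [hs.2]))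
    exact hc.tendsto.mono_left inf_le_left
  unfold weylRight
  exact ((hpow.smul (hlim.sub_const _)).add (hint.const_smul _)).const_smul _

/-- `Λ_α(g)` controls the right-sided Weyl derivatives, up to and including the endpoint `T`. -/
lemma norm_weylRight_le_Lam [CompleteSpace E] (hg : DriverBound α T D g) (hα : 0 < α)
    (hα1 : α < 1) {t : ℝ} (ht : t ∈ Ioc 0 T) {s : ℝ} (hs : s ∈ Ioo 0 t) :
    ‖weylRight α g t s‖ ≤ Real.Gamma (1 - α) * Lam α T g := by
  have key : ∀ t ∈ Ioo 0 T, ∀ s ∈ Ioo 0 t,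
      ‖weylRight α g t s‖ ≤ Real.Gamma (1 - α) * Lam α T g := by
    intro t ht s hs
    have hG : Real.Gamma (1 - α) ≠ 0 := (Real.Gamma_pos_of_pos (by linarith)).ne'
    rw [Lam, mul_inv_cancel_left₀ hG]
    have hfin : (⨆ t ∈ Ioo 0 T, ⨆ s ∈ Ioo 0 t, ‖weylRight α g t s‖ₑ) ≠ ∞ := by
      refine ne_top_of_le_ne_top (ENNReal.ofReal_ne_top (r := (Real.Gamma α)⁻¹ *
        (D + (1 - α) * D))) ?_
      refine iSup₂_le fun t ht => iSup₂_le fun s hs => ?_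
      rw [← ofReal_norm]
      exact ENNReal.ofReal_le_ofReal (hg.norm_weylRight_le hα hα1 ht hs)
    rw [← toReal_enorm]
    exact ENNReal.toReal_mono hfin (le_iSup₂_of_le t ht (le_iSup₂_of_le s hs le_rfl))
  rcases ht.2.eq_or_lt with rfl | h
  · refine le_of_tendsto (hg.tendsto_weylRight hα1 hs).norm ?_
    filter_upwards [Ioo_mem_nhdsLT hs.2] with v hv
    exact key v ⟨hs.1.trans hv.1, hv.2⟩ s ⟨hs.1, hv.1⟩
  · exact key t ⟨ht.1, h⟩ s hs

/-- The quantity `(t-s)^(1-α) ∫_s^t (g(u)-g(s)) (u-s)^(α-2) du` has derivative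
`Γ(α) (t-s)^(-α)` times the Weyl derivative, hence is bounded by its integral. -/
lemma norm_integral_kernel_le_of_weylRight [CompleteSpace E] (hg : DriverBound α T D g)
    (hα : 0 < α) (hα1 : α < 1) {R : ℝ}
    (hR : ∀ t ∈ Ioo 0 T, ∀ s ∈ Ioo 0 t, ‖weylRight α g t s‖ ≤ R)
    {t : ℝ} (ht : t ∈ Ioo 0 T) {s : ℝ} (hs : s ∈ Ioo 0 t) :
    (1 - α) * ‖∫ u in Ioo s t, ((u - s) ^ (2 - α))⁻¹ • (g u - g s)‖ ≤ Real.Gamma α * R := by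
  have hG : 0 < Real.Gamma α := Real.Gamma_pos_of_pos hα
  have hR0 : 0 ≤ R := (norm_nonneg _).trans (hR t ht s hs)
  have h1α : 0 < 1 - α := by linarith
  set k : ℝ → E := fun u => ((u - s) ^ (2 - α))⁻¹ • (g u - g s) with hk
  set P : ℝ → E := fun v => ∫ u in s..v, k u with hP
  have hPeq : ∀ v, s ≤ v → P v = ∫ u in Ioo s v, k u := fun v hv => by
    rw [hP]; simp only
    rw [intervalIntegral.integral_of_le hv, integral_Ioc_eq_integral_Ioo]
  have hPder : ∀ v ∈ Ioo s T, HasDerivAt P (k v) v := by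
    intro v hv
    have hk1 := hg.continuousOn_kernel hα1 hs.1
    refine intervalIntegral.integral_hasDerivAt_right
      (hg.intervalIntegrable_kernel hα1 ⟨hs.1.trans hv.1, hv.2.le⟩ ⟨hs.1, hv.1⟩) ?_
      (hk1.continuousAt (isOpen_Ioo.mem_nhds hv))
    exact hk1.stronglyMeasurableAtFilter isOpen_Ioo v hv
  set F : ℝ → E := fun v => (v - s) ^ (1 - α) • P v with hF
  have hFder : ∀ v ∈ Ioo s T,
      HasDerivAt F ((v - s) ^ (-α) • (Real.Gamma α • weylRight α g v s)) v := by
    intro v hv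
    have hvs : 0 < v - s := by linarith [hv.1]
    have h1 : HasDerivAt (fun v => (v - s) ^ (1 - α)) ((1 - α) * (v - s) ^ (-α)) v := by
      have := ((hasDerivAt_id v).sub_const s).rpow_const (p := 1 - α) (Or.inl hvs.ne')
      simpa [mul_comm, show (1 - α - 1) = -α by ring] using this
    refine (h1.smul (hPder v hv)).congr_deriv ?_
    symm
    rw [weylRight, smul_inv_smul₀ hG.ne', hg.leftLim_eq hα1 ⟨hs.1.trans hv.1, hv.2⟩,
      ← hPeq v hv.1.le, hk, smul_add, smul_smul, smul_smul, smul_smul]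
    congr 2
    · rw [← Real.rpow_neg hvs.le, ← Real.rpow_neg hvs.le, ← Real.rpow_add hvs,
        ← Real.rpow_add hvs]
      congr 1; ring
    · ring
  -- The differential inequality is run from a > s, away from the singularity at s, and then a tends
  -- to s.
  have hFbound : ∀ a ∈ Ioo s t,
      ‖F t‖ ≤ ‖F a‖ + Real.Gamma α * R * ((t - s) ^ (1 - α) / (1 - α)) := by
    intro a ha
    have hsub : ∀ v ∈ Icc a t, v ∈ Ioo s T := fun v hv =>
      ⟨ha.1.trans_le hv.1, hv.2.trans_lt ht.2⟩
    have hBder : ∀ v ∈ Icc a t,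
        HasDerivAt (fun v => ‖F a‖ + Real.Gamma α * R * ((v - s) ^ (1 - α) / (1 - α)))
          (Real.Gamma α * R * (v - s) ^ (-α)) v := by
      intro v hv
      have hvs : v - s ≠ 0 := by linarith [(hsub v hv).1]
      have := ((((hasDerivAt_id v).sub_const s).rpow_const (p := 1 - α)
        (Or.inl hvs)).div_const (1 - α)).const_mul (Real.Gamma α * R)
      refine (this.const_add ‖F a‖).congr_deriv ?_
      simp only [id, show (1 - α - 1) = -α by ring]
      field_simp
    refine image_norm_le_of_norm_deriv_right_le_deriv_boundary'
      (f' := fun v => (v - s) ^ (-α) • (Real.Gamma α • weylRight α g v s))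
      (B := fun v => ‖F a‖ + Real.Gamma α * R * ((v - s) ^ (1 - α) / (1 - α)))
      (B' := fun v => Real.Gamma α * R * (v - s) ^ (-α))
      (fun v hv => (hFder v (hsub v hv)).continuousAt.continuousWithinAt)
      (fun v hv => (hFder v (hsub v (Ico_subset_Icc_self hv))).hasDerivWithinAt)
      ?_ (fun v hv => (hBder v hv).continuousAt.continuousWithinAt)
      (fun v hv => (hBder v (Ico_subset_Icc_self hv)).hasDerivWithinAt) ?_
      (right_mem_Icc.2 ha.2.le)
    · have : 0 ≤ (a - s) ^ (1 - α) := Real.rpow_nonneg (by linarith [ha.1]) _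
      simp only [le_add_iff_nonneg_right]
      positivity
    · intro v hv
      have hv' := hsub v (Ico_subset_Icc_self hv)
      have h0 : 0 ≤ (v - s) ^ (-α) := Real.rpow_nonneg (by linarith [hv'.1]) _
      rw [norm_smul, norm_smul, Real.norm_of_nonneg h0, Real.norm_of_nonneg hG.le, mul_comm]
      have := hR v ⟨hs.1.trans hv'.1, hv'.2⟩ s ⟨hs.1, hv'.1⟩
      gcongr
  -- The constant D enters only here, multiplied by (a-s)^{1-α}, so it vanishes in the limit and the
  -- final bound depends on R alone.
  have hF0 : Tendsto (fun a => ‖F a‖ + Real.Gamma α * R * ((t - s) ^ (1 - α) / (1 - α)))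
      (𝓝[>] s) (𝓝 (0 + Real.Gamma α * R * ((t - s) ^ (1 - α) / (1 - α)))) := by
    refine Tendsto.add_const _ ?_
    have h1 : Tendsto (fun a => (a - s) ^ (1 - α) * D) (𝓝[>] s) (𝓝 0) := by
      have hc : Continuous fun a => (a - s) ^ (1 - α) * D := by
        have : Continuous fun a => (a - s) ^ (1 - α) :=
          Continuous.rpow_const (by fun_prop) fun _ => Or.inr h1α.le
        fun_prop
      have := hc.tendsto s
      simp only [sub_self, Real.zero_rpow h1α.ne', zero_mul] at this
      exact this.mono_left inf_le_left
    refine squeeze_zero' (Eventually.of_forall fun _ => norm_nonneg _) ?_ h1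
    filter_upwards [Ioo_mem_nhdsGT hs.2] with a ha
    have h0 : 0 ≤ (a - s) ^ (1 - α) := Real.rpow_nonneg (by linarith [ha.1]) _
    rw [hF]; simp only
    rw [norm_smul, Real.norm_of_nonneg h0, hPeq a ha.1.le]
    gcongr
    exact hg.norm_integral_kernel_le ⟨hs.1.trans ha.1, (ha.2.trans ht.2).le⟩ ⟨hs.1, ha.1⟩
  have hfin := ge_of_tendsto hF0 (by
    filter_upwards [Ioo_mem_nhdsGT hs.2] with a ha using hFbound a ha)
  have h0 : 0 < (t - s) ^ (1 - α) := Real.rpow_pos_of_pos (by linarith [hs.2]) _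
  rw [hF] at hfin; simp only at hfin
  rw [norm_smul, Real.norm_of_nonneg h0.le, hPeq t hs.2.le, zero_add] at hfin
  have h3 : (t - s) ^ (1 - α) * ‖∫ u in Ioo s t, k u‖
      ≤ (t - s) ^ (1 - α) * (Real.Gamma α * R / (1 - α)) := hfin.trans_eq (by ring)
  have h4 := le_of_mul_le_mul_left h3 h0
  rw [le_div_iff₀ h1α] at h4
  linarith

/-- The Hölder constant of the driver is controlled by its Weyl derivatives. -/
lemma norm_sub_le_of_weylRight [CompleteSpace E] (hg : DriverBound α T D g)
    (hα : 0 < α) (hα1 : α < 1) {R : ℝ}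
    (hR : ∀ t ∈ Ioo 0 T, ∀ s ∈ Ioo 0 t, ‖weylRight α g t s‖ ≤ R)
    {t : ℝ} (ht : t ∈ Ioo 0 T) {s : ℝ} (hs : s ∈ Ioo 0 t) :
    ‖g t - g s‖ ≤ 2 * (Real.Gamma α * R) * (t - s) ^ (1 - α) := by
  have hG : 0 < Real.Gamma α := Real.Gamma_pos_of_pos hα
  have h0 : 0 < (t - s) ^ (1 - α) := Real.rpow_pos_of_pos (by linarith [hs.2]) _
  have h1 := hg.norm_integral_kernel_le_of_weylRight hα hα1 hR ht hs
  have h2 := hR t ht s hs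
  set P := ∫ u in Ioo s t, ((u - s) ^ (2 - α))⁻¹ • (g u - g s) with hP
  have h3 : g t - g s
      = (t - s) ^ (1 - α) • (Real.Gamma α • weylRight α g t s - (1 - α) • P) := by
    rw [weylRight, smul_inv_smul₀ hG.ne', hg.leftLim_eq hα1 ht, add_sub_cancel_right,
      smul_inv_smul₀ h0.ne']
  rw [h3, norm_smul, Real.norm_of_nonneg h0.le, mul_comm]
  gcongr
  refine (norm_sub_le _ _).trans ?_
  rw [norm_smul, norm_smul, Real.norm_of_nonneg hG.le, Real.norm_of_nonneg (by linarith)]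
  nlinarith [mul_le_mul_of_nonneg_left h2 hG.le]

lemma norm_leftLim_sub_le [CompleteSpace E] (hg : DriverBound α T D g)
    (hα : 0 < α) (hα1 : α < 1) {R : ℝ}
    (hR : ∀ t ∈ Ioo 0 T, ∀ s ∈ Ioo 0 t, ‖weylRight α g t s‖ ≤ R)
    {t : ℝ} (ht : t ∈ Ioc 0 T) {s : ℝ} (hs : s ∈ Ioo 0 t) :
    ‖Function.leftLim g t - g s‖ ≤ 2 * (Real.Gamma α * R) * (t - s) ^ (1 - α) := by
  rcases ht.2.eq_or_lt with rfl | h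
  · have hc : Continuous fun v => 2 * (Real.Gamma α * R) * (v - s) ^ (1 - α) := by
      have : Continuous fun v => (v - s) ^ (1 - α) :=
        Continuous.rpow_const (by fun_prop) fun _ => Or.inr (by linarith)
      fun_prop
    refine le_of_tendsto_of_tendsto ((hg.tendsto_leftLim hα1 ht.1).sub_const _).norm
      ((hc.tendsto t).mono_left inf_le_left) ?_
    filter_upwards [Ioo_mem_nhdsLT hs.2] with v hv
    exact hg.norm_sub_le_of_weylRight hα hα1 hR ⟨hs.1.trans hv.1, hv.2⟩ ⟨hs.1, hv.1⟩
  · rw [hg.leftLim_eq hα1 ⟨ht.1, h⟩]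
    exact hg.norm_sub_le_of_weylRight hα hα1 hR ⟨ht.1, h⟩ hs

end DriverBound

end Driver

/-! ### The right-sided Weyl derivative: upper limit and measurability. -/

section WeylRight

variable {E : Type*} [NormedAddCommGroup E] [NormedSpace ℝ E]

namespace DriverBound

variable {α T D : ℝ} {g : ℝ → E}

/-- Dependence of the right-sided Weyl derivative on its upper limit. -/
lemma norm_weylRight_sub_le [CompleteSpace E] (hg : DriverBound α T D g)
    (hα : 0 < α) (hα1 : α < 1) {R : ℝ}
    (hR : ∀ t ∈ Ioo 0 T, ∀ s ∈ Ioo 0 t, ‖weylRight α g t s‖ ≤ R)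
    {t s u : ℝ} (ht : t ∈ Ioc 0 T) (hs : s ∈ Ioo 0 t) (hu : u ∈ Ioo 0 s) :
    ‖weylRight α g t u - weylRight α g s u‖
      ≤ 4 * R * ((t - s) ^ (1 - α) * (s - u) ^ (-(1 - α))) := by
  have hG : 0 < Real.Gamma α := Real.Gamma_pos_of_pos hα
  have h1α : 0 < 1 - α := by linarith
  have hsT : s ∈ Ioo 0 T := ⟨hs.1, hs.2.trans_le ht.2⟩
  have hut : u ∈ Ioo 0 t := ⟨hu.1, hu.2.trans hs.2⟩
  have hsu : 0 < s - u := by linarith [hu.2]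
  have hts : 0 < t - s := by linarith [hs.2]
  have hR0 : 0 ≤ R := (norm_nonneg _).trans (hR s hsT u hu)
  set κ : ℝ → ℝ := fun w => ((w - u) ^ (2 - α))⁻¹ with hκ
  have hκ' : ∀ w, u < w → κ w = (w - u) ^ (α - 2) := fun w hw => by
    rw [hκ]; simp only
    rw [← Real.rpow_neg (by linarith), neg_sub]
  have hk1 := hg.intervalIntegrable_kernel hα1 ht hut
  have hk2 := hg.intervalIntegrable_kernel hα1 ⟨hsT.1, hsT.2.le⟩ hu
  have hk3 : IntervalIntegrable (fun w => κ w • (g w - g u)) volume s t := hk2.symm.trans hk1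
  have hκc : ContinuousOn κ (uIcc s t) := by
    rw [uIcc_of_le hs.2.le]
    refine ContinuousOn.inv₀ ?_ fun w hw =>
      (Real.rpow_pos_of_pos (by linarith [hw.1, hu.2]) _).ne'
    exact ContinuousOn.rpow_const (by fun_prop) fun w hw => Or.inl (by linarith [hw.1, hu.2])
  have hκint : (1 - α) * ∫ w in s..t, κ w = ((s - u) ^ (1 - α))⁻¹ - ((t - u) ^ (1 - α))⁻¹ := by
    have e : ∫ w in s..t, κ w = ∫ w in s..t, (w - u) ^ (α - 2) := by
      refine intervalIntegral.integral_congr fun w hw => ?_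
      rw [uIcc_of_le hs.2.le] at hw
      exact hκ' w (hu.2.trans_le hw.1)
    have h0 : (0 : ℝ) ∉ uIcc (s - u) (t - u) := by
      rw [uIcc_of_le (by linarith)]
      exact fun h => by linarith [h.1]
    rw [e, intervalIntegral.integral_comp_sub_right (fun w => w ^ (α - 2)) u,
      integral_rpow (Or.inr ⟨by linarith, h0⟩), show α - 2 + 1 = -(1 - α) by ring,
      Real.rpow_neg hsu.le, Real.rpow_neg (by linarith)]
    field_simp
    ring
  set Q : E := ∫ w in s..t, κ w • (g w - g s) with hQ
  have hQeq : ∫ w in s..t, κ w • (g w - g u) = Q + (∫ w in s..t, κ w) • (g s - g u) := by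
    have hc : IntervalIntegrable (fun w => κ w • (g s - g u)) volume s t :=
      (hκc.smul continuousOn_const).intervalIntegrable
    have hc' : IntervalIntegrable (fun w => κ w • (g w - g s)) volume s t := by
      refine (hk3.sub hc).congr fun w _ => ?_
      rw [← smul_sub, sub_sub_sub_cancel_right]
    rw [hQ, ← intervalIntegral.integral_smul_const, ← intervalIntegral.integral_add hc' hc]
    refine intervalIntegral.integral_congr fun w _ => ?_
    rw [← smul_add, sub_add_sub_cancel]
  -- By `hκint` the terms containing g(s) - g(u) cancel, which leaves only increments of g after
  -- time s.
  have hmain : weylRight α g t u - weylRight α g s u = (Real.Gamma α)⁻¹ •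
      (((t - u) ^ (1 - α))⁻¹ • (Function.leftLim g t - g s) + (1 - α) • Q) := by
    have hsplit := intervalIntegral.integral_interval_sub_left hk1 hk2
    rw [intervalIntegral.integral_of_le hut.2.le, intervalIntegral.integral_of_le hu.2.le,
      integral_Ioc_eq_integral_Ioo, integral_Ioc_eq_integral_Ioo] at hsplit
    change _ = ∫ w in s..t, κ w • (g w - g u) at hsplit
    rw [hQeq, sub_eq_iff_eq_add] at hsplit
    rw [weylRight, weylRight, ← smul_sub, hsplit, hg.leftLim_eq hα1 hsT, smul_add, smul_add,
      smul_smul (1 - α), hκint]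
    congr 1
    module
  have hgt := hg.norm_leftLim_sub_le hα hα1 hR ht hs
  have hQle : ‖Q‖ ≤ 2 * (Real.Gamma α * R) * (s - u) ^ (-(1 - α)) *
      ((t - s) ^ (1 - α) / (1 - α)) := by
    have hb : ‖Q‖ ≤ ∫ w in s..t,
        2 * (Real.Gamma α * R) * (s - u) ^ (-(1 - α)) * (w - s) ^ (-α) := by
      refine intervalIntegral.norm_integral_le_of_norm_le hs.2.le ?_
        ((intervalIntegrable_sub_rpow_left hα1).const_mul _)
      -- The endpoint w = t is discarded as a null set: it may be T, where the Hölder bound on g is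
      -- not available.
      filter_upwards [compl_mem_ae_iff.2 (measure_singleton t)] with w hwt hw
      have hwt' : w < t := lt_of_le_of_ne hw.2 hwt
      have hws : 0 < w - s := by linarith [hw.1]
      have hwu : 0 < w - u := by linarith [hw.1]
      have h1 := hg.norm_sub_le_of_weylRight hα hα1 hR (t := w)
        ⟨hs.1.trans hw.1, hwt'.trans_le ht.2⟩ ⟨hs.1, hw.1⟩
      -- The exponent is split so that (w-s)^{-1}, against the Hölder bound (w-s)^{1-α}, leaves the
      -- integrable (w-s)^{-α}.
      have h2 : (w - u) ^ (α - 2) ≤ (s - u) ^ (-(1 - α)) * (w - s)⁻¹ := by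
        rw [show α - 2 = -(1 - α) - 1 by ring, Real.rpow_sub_one hwu.ne', div_eq_mul_inv]
        refine mul_le_mul (Real.rpow_le_rpow_of_nonpos hsu (by linarith [hw.1]) (by linarith))
          (inv_anti₀ hws (by linarith [hu.2])) (by positivity) (by positivity)
      rw [norm_smul, hκ' w (hu.2.trans hw.1), Real.norm_of_nonneg (by positivity)]
      calc (w - u) ^ (α - 2) * ‖g w - g s‖
          ≤ ((s - u) ^ (-(1 - α)) * (w - s)⁻¹) *
            (2 * (Real.Gamma α * R) * (w - s) ^ (1 - α)) := by gcongr
        _ = _ := by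
          rw [show -α = 1 - α - 1 by ring, Real.rpow_sub_one hws.ne']
          ring
    refine hb.trans_eq ?_
    rw [intervalIntegral.integral_const_mul,
      intervalIntegral.integral_comp_sub_right (fun w => w ^ (-α)) s, sub_self,
      integral_rpow (Or.inl (by linarith)), show -α + 1 = 1 - α by ring,
      Real.zero_rpow h1α.ne', sub_zero]
  have hpow : ((t - u) ^ (1 - α))⁻¹ ≤ (s - u) ^ (-(1 - α)) := by
    rw [← Real.rpow_neg (by linarith [hut.2])]
    exact Real.rpow_le_rpow_of_nonpos hsu (by linarith) (by linarith)
  have hpos : 0 ≤ ((t - u) ^ (1 - α))⁻¹ := by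
    have : 0 < t - u := by linarith [hut.2]
    positivity
  rw [hmain, norm_smul, norm_inv, Real.norm_of_nonneg hG.le, inv_mul_le_iff₀ hG]
  refine (norm_add_le _ _).trans ?_
  rw [norm_smul, norm_smul, Real.norm_of_nonneg hpos, Real.norm_of_nonneg h1α.le]
  calc _ ≤ (s - u) ^ (-(1 - α)) * (2 * (Real.Gamma α * R) * (t - s) ^ (1 - α)) +
        (1 - α) * (2 * (Real.Gamma α * R) * (s - u) ^ (-(1 - α)) *
          ((t - s) ^ (1 - α) / (1 - α))) := by gcongr
    _ = _ := by field_simp; ring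

/-- Replacing g by a globally measurable h that agrees with it on (0,T) turns the inner integral
into a section integral of a jointly measurable function on the plane. -/
lemma aestronglyMeasurable_weylRight (hg : DriverBound α T D g) (hα1 : α < 1) {t : ℝ}
    (ht : t ∈ Ioc 0 T) :
    AEStronglyMeasurable (weylRight α g t) (volume.restrict (Ioo 0 t)) := by
  obtain ⟨h, hm, hh⟩ := (MeasurableEmbedding.subtype_coe
    (measurableSet_Ioo (a := (0 : ℝ)) (b := T))).exists_stronglyMeasurable_extend
      ((continuousOn_iff_continuous_domRestrict.1 (hg.continuousOn hα1)).stronglyMeasurable)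
      (fun _ => ⟨0⟩)
  have hh' : ∀ u ∈ Ioo 0 T, h u = g u := fun u hu => congrFun hh ⟨u, hu⟩
  set F : ℝ × ℝ → E := {p : ℝ × ℝ | p.1 < p.2 ∧ p.2 < t}.indicator
    fun p => ((p.2 - p.1) ^ (2 - α))⁻¹ • (h p.2 - h p.1) with hF
  have hFm : StronglyMeasurable F := by
    refine StronglyMeasurable.indicator ?_ ?_
    · refine StronglyMeasurable.smul (Measurable.stronglyMeasurable (by fun_prop)) ?_
      exact (hm.comp_measurable measurable_snd).sub (hm.comp_measurable measurable_fst)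
    · exact (measurableSet_lt measurable_fst measurable_snd).inter
        (measurableSet_lt measurable_snd measurable_const)
  have hS : StronglyMeasurable fun u => (Real.Gamma α)⁻¹ •
      (((t - u) ^ (1 - α))⁻¹ • (Function.leftLim g t - h u) + (1 - α) • ∫ w, F (u, w)) := by
    refine StronglyMeasurable.const_smul (StronglyMeasurable.add ?_ ?_) _
    · exact StronglyMeasurable.smul (Measurable.stronglyMeasurable (by fun_prop))
        (stronglyMeasurable_const.sub hm)
    · exact hFm.integral_prod_right'.const_smul _
  refine hS.aestronglyMeasurable.congr ?_
  filter_upwards [ae_restrict_mem measurableSet_Ioo] with u hu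
  have huT : u ∈ Ioo 0 T := ⟨hu.1, hu.2.trans_le ht.2⟩
  have : ∫ w, F (u, w) = ∫ w in Ioo u t, ((w - u) ^ (2 - α))⁻¹ • (g w - g u) := by
    rw [← integral_indicator measurableSet_Ioo]
    congr 1
    ext w
    by_cases hw : w ∈ Ioo u t
    · rw [indicator_of_mem hw, hF, indicator_of_mem (by exact hw)]
      simp only
      rw [hh' w ⟨hu.1.trans hw.1, hw.2.trans_le ht.2⟩, hh' u huT]
    · rw [indicator_of_notMem hw, hF, indicator_of_notMem (by exact hw)]
  rw [weylRight, this, hh' u huT]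

end DriverBound

end WeylRight

/-! ### The left-sided Weyl derivative and its majorant. -/

section WeylLeft

variable {E : Type*} [NormedAddCommGroup E]

/-- The pointwise majorant `|f(u)| u^{-α} + ∫_0^u |f(u)-f(v)| / (u-v)^{α+1} dv` of the left-sided
Weyl derivative. -/
noncomputable def weylMajorant (α : ℝ) (f : ℝ → E) (u : ℝ) : ℝ≥0∞ :=
  ‖f u‖ₑ * ENNReal.ofReal (u ^ (-α)) +
    ∫⁻ v in Ioo 0 u, ENNReal.ofReal (‖f u - f v‖ / (u - v) ^ (α + 1))

lemma measurable_weylMajorant {α : ℝ} {f : ℝ → E} (hf : Continuous f) :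
    Measurable (weylMajorant α f) := by
  set F : ℝ × ℝ → ℝ≥0∞ := {p : ℝ × ℝ | 0 < p.2 ∧ p.2 < p.1}.indicator
    fun p => ENNReal.ofReal (‖f p.1 - f p.2‖ / (p.1 - p.2) ^ (α + 1)) with hF
  have hFm : Measurable F := by
    refine Measurable.indicator ?_ ?_
    · have : Measurable fun p : ℝ × ℝ => ‖f p.1 - f p.2‖ :=
        Continuous.measurable (by fun_prop)
      fun_prop
    · exact (measurableSet_lt measurable_const measurable_snd).inter
        (measurableSet_lt measurable_snd measurable_fst)
  have h2 : (fun u => ∫⁻ v in Ioo 0 u, ENNReal.ofReal (‖f u - f v‖ / (u - v) ^ (α + 1)))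
      = fun u => ∫⁻ v, F (u, v) := by
    ext u
    rw [← lintegral_indicator measurableSet_Ioo]
    congr 1
  have h1 : Measurable fun u => ‖f u‖ₑ := Continuous.measurable (by fun_prop)
  unfold weylMajorant
  refine Measurable.add (h1.mul (by fun_prop)) ?_
  rw [h2]
  exact hFm.lintegral_prod_right'

variable [NormedSpace ℝ E]

lemma stronglyMeasurable_weylLeft {α : ℝ} {f : ℝ → E} (hf : Continuous f) :
    StronglyMeasurable (weylLeft α f) := by
  set F : ℝ × ℝ → E := {p : ℝ × ℝ | 0 < p.2 ∧ p.2 < p.1}.indicator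
    fun p => ((p.1 - p.2) ^ (α + 1))⁻¹ • (f p.1 - f p.2) with hF
  have hFm : StronglyMeasurable F := by
    refine StronglyMeasurable.indicator ?_ ?_
    · refine StronglyMeasurable.smul (Measurable.stronglyMeasurable (by fun_prop)) ?_
      exact (hf.stronglyMeasurable.comp_measurable measurable_fst).sub
        (hf.stronglyMeasurable.comp_measurable measurable_snd)
    · exact (measurableSet_lt measurable_const measurable_snd).inter
        (measurableSet_lt measurable_snd measurable_fst)
  have h2 : (fun u => ∫ v in Ioo 0 u, ((u - v) ^ (α + 1))⁻¹ • (f u - f v))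
      = fun u => ∫ v, F (u, v) := by
    ext u
    rw [← integral_indicator measurableSet_Ioo]
    congr 1
  have h3 : weylLeft α f = fun u => (Real.Gamma (1 - α))⁻¹ •
      ((u ^ α)⁻¹ • f u + α • (fun u => ∫ v, F (u, v)) u) := by
    rw [← h2]; rfl
  rw [h3]
  refine StronglyMeasurable.const_smul (StronglyMeasurable.add ?_ ?_) _
  · exact StronglyMeasurable.smul (Measurable.stronglyMeasurable (by fun_prop))
      hf.stronglyMeasurable
  · exact hFm.integral_prod_right'.const_smul _

lemma enorm_weylLeft_le {α : ℝ} (hα : 0 < α) (hα1 : α < 1) (f : ℝ → E) {u : ℝ} (hu : 0 < u) :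
    ‖weylLeft α f u‖ₑ ≤ ENNReal.ofReal (Real.Gamma (1 - α))⁻¹ * weylMajorant α f u := by
  have hG : 0 < (Real.Gamma (1 - α))⁻¹ := inv_pos.2 (Real.Gamma_pos_of_pos (by linarith))
  rw [weylLeft, enorm_smul, Real.enorm_eq_ofReal hG.le]
  gcongr
  refine (enorm_add_le _ _).trans ?_
  unfold weylMajorant
  gcongr
  · rw [enorm_smul, mul_comm, ← Real.rpow_neg hu.le,
      Real.enorm_eq_ofReal (Real.rpow_nonneg hu.le _)]
  · rw [enorm_smul, Real.enorm_eq_ofReal hα.le]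
    calc _ ≤ 1 * ‖∫ v in Ioo 0 u, ((u - v) ^ (α + 1))⁻¹ • (f u - f v)‖ₑ := by
          gcongr
          exact ENNReal.ofReal_le_one.2 hα1.le
      _ ≤ _ := by
          rw [one_mul]
          refine (enorm_integral_le_lintegral_enorm _).trans (le_of_eq ?_)
          refine setLIntegral_congr_fun measurableSet_Ioo fun v hv => ?_
          rw [← ofReal_norm, norm_smul, norm_inv, Real.norm_of_nonneg, div_eq_inv_mul]
          exact Real.rpow_nonneg (by linarith [hv.2]) _

end WeylLeft

/-- Tonelli's theorem on a triangle. -/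
lemma lintegral_triangle_swap {F : ℝ → ℝ → ℝ≥0∞} (hF : Measurable (Function.uncurry F))
    (a b : ℝ) :
    ∫⁻ s in Ioo a b, ∫⁻ u in Ioo s b, F s u = ∫⁻ u in Ioo a b, ∫⁻ s in Ioo a u, F s u := by
  set G : ℝ → ℝ → ℝ≥0∞ := fun s u =>
    {p : ℝ × ℝ | a < p.1 ∧ p.1 < p.2 ∧ p.2 < b}.indicator (Function.uncurry F) (s, u) with hG
  have hGm : Measurable (Function.uncurry G) := by
    refine hF.indicator ?_
    exact (measurableSet_lt measurable_const measurable_fst).inter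
      ((measurableSet_lt measurable_fst measurable_snd).inter
        (measurableSet_lt measurable_snd measurable_const))
  have h1 : ∫⁻ s in Ioo a b, ∫⁻ u in Ioo s b, F s u = ∫⁻ s, ∫⁻ u, G s u := by
    rw [← lintegral_indicator measurableSet_Ioo]
    congr 1
    ext s
    by_cases hs : s ∈ Ioo a b
    · rw [indicator_of_mem hs, ← lintegral_indicator measurableSet_Ioo]
      congr 1
      ext u
      simp only [hG, indicator, mem_Ioo, mem_ofPred_eq, hs.1, true_and, Function.uncurry]
    · rw [indicator_of_notMem hs]
      symm
      rw [lintegral_eq_zero_of_ae_eq_zero]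
      refine ae_of_all _ fun u => indicator_of_notMem (fun h => hs ?_) _
      exact ⟨h.1, h.2.1.trans h.2.2⟩
  have h2 : ∫⁻ u in Ioo a b, ∫⁻ s in Ioo a u, F s u = ∫⁻ u, ∫⁻ s, G s u := by
    rw [← lintegral_indicator measurableSet_Ioo]
    congr 1
    ext u
    by_cases hu : u ∈ Ioo a b
    · rw [indicator_of_mem hu, ← lintegral_indicator measurableSet_Ioo]
      congr 1
      ext s
      simp only [hG, indicator, mem_Ioo, mem_ofPred_eq, hu.2, and_true, Function.uncurry]
    · rw [indicator_of_notMem hu]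
      symm
      rw [lintegral_eq_zero_of_ae_eq_zero]
      refine ae_of_all _ fun s => indicator_of_notMem (fun h => hu ?_) _
      exact ⟨h.1.trans h.2.1, h.2.2⟩
  rw [h1, h2]
  exact lintegral_lintegral_swap hGm.aemeasurable

/-! ### Size and increments of the generalized Stieltjes integral. -/

section Stieltjes

variable {d m : ℕ} {α T D : ℝ} {g : ℝ → Vec m} {f : ℝ → Mat d m}

namespace DriverBound

lemma aestronglyMeasurable_weyl (hg : DriverBound α T D g) (hα1 : α < 1)
    (hf : Continuous f) {t : ℝ} (ht : t ∈ Ioc 0 T) :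
    AEStronglyMeasurable (fun u => weylLeft α f u (weylRight α g t u))
      (volume.restrict (Ioo 0 t)) :=
  isBoundedBilinearMap_apply.continuous.comp_aestronglyMeasurable₂
    (stronglyMeasurable_weylLeft hf).aestronglyMeasurable
    (hg.aestronglyMeasurable_weylRight hα1 ht)

/-- The normalization Γ(1-α)⁻¹ of the left derivative cancels the Γ(1-α) in the bound of the right
one by Λ. -/
lemma enorm_weyl_le (hg : DriverBound α T D g) (hα : 0 < α) (hα1 : α < 1) {t u : ℝ}
    (ht : t ∈ Ioc 0 T) (hu : u ∈ Ioo 0 t) :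
    ‖weylLeft α f u (weylRight α g t u)‖ₑ
      ≤ ENNReal.ofReal (Lam α T g) * weylMajorant α f u := by
  have hG : 0 < Real.Gamma (1 - α) := Real.Gamma_pos_of_pos (by linarith)
  refine (ContinuousLinearMap.le_opENorm _ _).trans ?_
  refine (mul_le_mul' (enorm_weylLeft_le hα hα1 f hu.1)
    (le_of_eq_of_le (ofReal_norm _).symm
      (ENNReal.ofReal_le_ofReal (hg.norm_weylRight_le_Lam hα hα1 ht hu)))).trans (le_of_eq ?_)
  rw [mul_right_comm, ← ENNReal.ofReal_mul (inv_pos.2 hG).le, inv_mul_cancel_left₀ hG.ne']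

lemma integrableOn_weyl (hg : DriverBound α T D g) (hα : 0 < α) (hα1 : α < 1)
    (hf : Continuous f) {t : ℝ} (ht : t ∈ Ioc 0 T)
    (hfin : ∫⁻ u in Ioo 0 t, weylMajorant α f u ≠ ∞) :
    IntegrableOn (fun u => weylLeft α f u (weylRight α g t u)) (Ioo 0 t) := by
  refine ⟨hg.aestronglyMeasurable_weyl hα1 hf ht, ?_⟩
  refine lt_of_le_of_lt (setLIntegral_mono' measurableSet_Ioo fun u hu =>
    hg.enorm_weyl_le hα hα1 ht hu) ?_
  rw [lintegral_const_mul _ (measurable_weylMajorant hf)]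
  exact ENNReal.mul_lt_top ENNReal.ofReal_lt_top hfin.lt_top

lemma enorm_stieltjes_le (hg : DriverBound α T D g) (hα : 0 < α) (hα1 : α < 1)
    (hf : Continuous f) {t : ℝ} (ht : t ∈ Ioc 0 T) :
    ‖stieltjes α f g t‖ₑ
      ≤ ENNReal.ofReal (Lam α T g) * ∫⁻ u in Ioo 0 t, weylMajorant α f u := by
  refine (enorm_integral_le_lintegral_enorm _).trans ?_
  rw [← lintegral_const_mul _ (measurable_weylMajorant hf)]
  exact setLIntegral_mono' measurableSet_Ioo fun u hu => hg.enorm_weyl_le hα hα1 ht hu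

/-- Changing the upper limit from s to t adds the integral over (s,t) and also alters the integrand
on (0,s) through the right-sided derivative. The second term pays for that alteration by
`norm_weylRight_sub_le`. -/
lemma enorm_stieltjes_sub_le (hg : DriverBound α T D g) (hα : 0 < α) (hα1 : α < 1)
    (hf : Continuous f) {t s : ℝ} (ht : t ∈ Ioc 0 T) (hs : s ∈ Ioo 0 t)
    (hfin : ∫⁻ u in Ioo 0 t, weylMajorant α f u ≠ ∞) :
    ‖stieltjes α f g t - stieltjes α f g s‖ₑ
      ≤ ENNReal.ofReal (Lam α T g) * (∫⁻ u in Ioo s t, weylMajorant α f u) +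
        ENNReal.ofReal (4 * Lam α T g) * ∫⁻ u in Ioo 0 s,
          ENNReal.ofReal ((t - s) ^ (1 - α) * (s - u) ^ (-(1 - α))) * weylMajorant α f u := by
  have hG : 0 < Real.Gamma (1 - α) := Real.Gamma_pos_of_pos (by linarith)
  have hs' : s ∈ Ioc 0 T := ⟨hs.1, hs.2.le.trans ht.2⟩
  have hsub : Ioo 0 s ⊆ Ioo 0 t := Ioo_subset_Ioo_right hs.2.le
  have hsub' : Ioo s t ⊆ Ioo 0 t := Ioo_subset_Ioo_left hs.1.le
  have hit := hg.integrableOn_weyl hα hα1 hf ht hfin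
  have his := hg.integrableOn_weyl hα hα1 hf hs'
    (ne_top_of_le_ne_top hfin (lintegral_mono_set hsub))
  have hsplit : stieltjes α f g t = (∫ u in Ioo 0 s, weylLeft α f u (weylRight α g t u)) +
      ∫ u in Ioo s t, weylLeft α f u (weylRight α g t u) := by
    have hdisj : Disjoint (Ioc 0 s) (Ioo s t) :=
      disjoint_left.2 fun u h1 h2 => absurd h1.2 (not_le.2 h2.1)
    rw [stieltjes, ← Ioc_union_Ioo_eq_Ioo hs.1.le hs.2, setIntegral_union hdisj
      measurableSet_Ioo _ (hit.mono_set hsub'), integral_Ioc_eq_integral_Ioo]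
    exact hit.mono_set (fun u hu => ⟨hu.1, hu.2.trans_lt hs.2⟩)
  have heq : stieltjes α f g t - stieltjes α f g s
      = (∫ u in Ioo s t, weylLeft α f u (weylRight α g t u)) +
        ∫ u in Ioo 0 s, weylLeft α f u (weylRight α g t u - weylRight α g s u) := by
    simp_rw [map_sub]
    rw [hsplit, integral_sub (hit.mono_set hsub) his, stieltjes]
    abel
  rw [heq]
  refine (enorm_add_le _ _).trans (add_le_add ?_ ?_)
  · refine (enorm_integral_le_lintegral_enorm _).trans ?_
    rw [← lintegral_const_mul _ (measurable_weylMajorant hf)]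
    exact setLIntegral_mono' measurableSet_Ioo fun u hu =>
      hg.enorm_weyl_le hα hα1 ht (hsub' hu)
  · refine (enorm_integral_le_lintegral_enorm _).trans ?_
    have hw := measurable_weylMajorant (α := α) hf
    rw [← lintegral_const_mul _ (by fun_prop)]
    refine setLIntegral_mono' measurableSet_Ioo fun u hu => ?_
    have hR := hg.norm_weylRight_sub_le hα hα1 (R := Real.Gamma (1 - α) * Lam α T g)
      (fun t ht s hs => hg.norm_weylRight_le_Lam hα hα1 ⟨ht.1, ht.2.le⟩ hs) ht hs hu
    refine (ContinuousLinearMap.le_opENorm _ _).trans ?_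
    refine (mul_le_mul' (enorm_weylLeft_le hα hα1 f hu.1)
      (le_of_eq_of_le (ofReal_norm _).symm (ENNReal.ofReal_le_ofReal hR))).trans (le_of_eq ?_)
    have hk : 0 ≤ (t - s) ^ (1 - α) * (s - u) ^ (-(1 - α)) :=
      mul_nonneg (Real.rpow_nonneg (by linarith [hs.2]) _)
        (Real.rpow_nonneg (by linarith [hu.2]) _)
    rw [mul_right_comm, ← ENNReal.ofReal_mul (inv_pos.2 hG).le,
      ← mul_assoc (ENNReal.ofReal (4 * Lam α T g)), ← ENNReal.ofReal_mul' hk]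
    congr 2
    field_simp

end DriverBound

/-- The convolution `∫_0^t w(u) (t-u)^{-α} du` of the majorant `w` of the Weyl derivative. -/
noncomputable def majorantConv (α : ℝ) (f : ℝ → Mat d m) (t : ℝ) : ℝ≥0∞ :=
  ∫⁻ u in Ioo 0 t, weylMajorant α f u * ENNReal.ofReal ((t - u) ^ (-α))

lemma lintegral_weylMajorant_le (hα : 0 < α) (hf : Continuous f) (t : ℝ) :
    ENNReal.ofReal (t ^ (-α)) * ∫⁻ u in Ioo 0 t, weylMajorant α f u ≤ majorantConv α f t := by
  rw [← lintegral_const_mul _ (measurable_weylMajorant hf)]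
  refine setLIntegral_mono' measurableSet_Ioo fun u hu => ?_
  rw [mul_comm]
  refine mul_le_mul_right (ENNReal.ofReal_le_ofReal ?_) _
  exact Real.rpow_le_rpow_of_nonpos (by linarith [hu.2]) (by linarith [hu.1]) (by linarith)

/-- Supplies the integrability needed to split and subtract the Bochner integrals behind
`stieltjes`. -/
lemma lintegral_weylMajorant_ne_top (hα : 0 < α) (hf : Continuous f) {t : ℝ} (ht : 0 < t)
    (hJ : majorantConv α f t ≠ ∞) : ∫⁻ u in Ioo 0 t, weylMajorant α f u ≠ ∞ := by
  intro h
  have := lintegral_weylMajorant_le hα hf t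
  rw [h, ENNReal.mul_top (by simpa using Real.rpow_pos_of_pos ht _)] at this
  exact hJ (top_le_iff.1 this)

namespace DriverBound

lemma rpow_mul_enorm_stieltjes_le (hg : DriverBound α T D g) (hα : 0 < α) (hα1 : α < 1)
    (hf : Continuous f) {t : ℝ} (ht : t ∈ Ioc 0 T) :
    ENNReal.ofReal (t ^ (-α)) * ‖stieltjes α f g t‖ₑ
      ≤ ENNReal.ofReal (Lam α T g) * majorantConv α f t := by
  calc _ ≤ ENNReal.ofReal (t ^ (-α)) *
        (ENNReal.ofReal (Lam α T g) * ∫⁻ u in Ioo 0 t, weylMajorant α f u) := by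
        gcongr; exact hg.enorm_stieltjes_le hα hα1 hf ht
    _ = ENNReal.ofReal (Lam α T g) *
        (ENNReal.ofReal (t ^ (-α)) * ∫⁻ u in Ioo 0 t, weylMajorant α f u) := by ring
    _ ≤ _ := by gcongr; exact lintegral_weylMajorant_le hα hf t

/-- The fractional integral of the increments of the Stieltjes integral. -/
lemma lintegral_stieltjes_sub_le (hg : DriverBound α T D g) (hα : 0 < α) (hα' : α < 1 / 2)
    (hf : Continuous f) {t : ℝ} (ht : t ∈ Ioc 0 T) (hJ : majorantConv α f t ≠ ∞) :
    ∫⁻ s in Ioo 0 t,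
        ENNReal.ofReal ((t - s) ^ (-α - 1)) * ‖stieltjes α f g t - stieltjes α f g s‖ₑ
      ≤ ENNReal.ofReal (Lam α T g *
          (1 / α + 4 * (2 ^ (2 * α) / α + 2 ^ (1 - α) / (1 - 2 * α)))) * majorantConv α f t := by
  have hα1 : α < 1 := by linarith
  have hΛ : 0 ≤ Lam α T g :=
    mul_nonneg (inv_nonneg.2 (Real.Gamma_pos_of_pos (by linarith)).le) ENNReal.toReal_nonneg
  have hw := measurable_weylMajorant (α := α) hf
  have hfin := lintegral_weylMajorant_ne_top hα hf ht.1 hJ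
  set C : ℝ := 2 ^ (2 * α) / α + 2 ^ (1 - α) / (1 - 2 * α) with hC
  have h12 : 0 < 1 - 2 * α := by linarith
  have hC0 : 0 ≤ C := by positivity
  set F₁ : ℝ → ℝ → ℝ≥0∞ := fun s u =>
    ENNReal.ofReal ((t - s) ^ (-α - 1)) * weylMajorant α f u with hF₁
  set F₂ : ℝ → ℝ → ℝ≥0∞ := fun s u =>
    ENNReal.ofReal ((t - s) ^ (-(2 * α)) * (s - u) ^ (-(1 - α))) * weylMajorant α f u with hF₂
  have hF₁m : Measurable (Function.uncurry F₁) := by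
    have h : Measurable fun p : ℝ × ℝ => weylMajorant α f p.2 := hw.comp measurable_snd
    exact Measurable.mul (by fun_prop) h
  have hF₂m : Measurable (Function.uncurry fun u s => F₂ s u) := by
    have h : Measurable fun p : ℝ × ℝ => weylMajorant α f p.1 := hw.comp measurable_fst
    exact Measurable.mul (by fun_prop) h
  -- Contribution of (s,t): after Tonelli the s-integral runs over s < u and leaves (t-u)^{-α}/α.
  have e1 : ∫⁻ s in Ioo 0 t, ∫⁻ u in Ioo s t, F₁ s u
      ≤ ENNReal.ofReal (1 / α) * majorantConv α f t := by
    rw [lintegral_triangle_swap hF₁m, majorantConv,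
      ← lintegral_const_mul _ (by fun_prop)]
    refine setLIntegral_mono' measurableSet_Ioo fun u hu => ?_
    rw [lintegral_mul_const _ (by fun_prop)]
    calc _ ≤ ENNReal.ofReal ((t - u) ^ (-α) / α) * weylMajorant α f u := by
          gcongr; exact lintegral_sub_rpow_neg_one_sub hα hu.1.le hu.2
      _ = _ := by
          rw [div_eq_mul_one_div, ENNReal.ofReal_mul' (by positivity)]
          ring
  -- Contribution of (0,s): the kernel exponents are 2α < 1 and 1-α < 1, and the Beta integral again
  -- produces (t-u)^{-α}.
  have e2 : ∫⁻ s in Ioo 0 t, ∫⁻ u in Ioo 0 s, F₂ s u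
      ≤ ENNReal.ofReal C * majorantConv α f t := by
    rw [← lintegral_triangle_swap hF₂m, majorantConv,
      ← lintegral_const_mul _ (by fun_prop)]
    refine setLIntegral_mono' measurableSet_Ioo fun u hu => ?_
    rw [lintegral_mul_const _ (by fun_prop)]
    calc _ ≤ ENNReal.ofReal (C * (t - u) ^ (-α)) * weylMajorant α f u := by
          gcongr
          have := lintegral_beta_le (p := 2 * α) (q := 1 - α) hu.2 (by linarith) (by linarith)
            (by linarith) (by linarith)
          rwa [show 1 - 2 * α - (1 - α) = -α by ring, sub_sub_cancel] at this
      _ = _ := by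
          rw [ENNReal.ofReal_mul hC0]
          ring
  calc _ ≤ ∫⁻ s in Ioo 0 t, (ENNReal.ofReal (Lam α T g) * (∫⁻ u in Ioo s t, F₁ s u) +
        ENNReal.ofReal (4 * Lam α T g) * ∫⁻ u in Ioo 0 s, F₂ s u) := by
        refine setLIntegral_mono' measurableSet_Ioo fun s hs => ?_
        have hts : 0 < t - s := by linarith [hs.2]
        have hk : 0 ≤ (t - s) ^ (-α - 1) := by positivity
        refine (mul_le_mul_right (hg.enorm_stieltjes_sub_le hα hα1 hf ht hs hfin) _).trans
          (le_of_eq ?_)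
        rw [mul_add, mul_left_comm, mul_left_comm (ENNReal.ofReal ((t - s) ^ (-α - 1))),
          ← lintegral_const_mul _ hw]
        congr 2
        rw [← lintegral_const_mul _ (by fun_prop)]
        refine lintegral_congr fun u => ?_
        rw [hF₂]
        simp only
        rw [← mul_assoc, ← ENNReal.ofReal_mul hk, ← mul_assoc, ← Real.rpow_add hts,
          show -α - 1 + (1 - α) = -(2 * α) by ring]
    _ = ENNReal.ofReal (Lam α T g) * (∫⁻ s in Ioo 0 t, ∫⁻ u in Ioo s t, F₁ s u) +
        ENNReal.ofReal (4 * Lam α T g) * ∫⁻ s in Ioo 0 t, ∫⁻ u in Ioo 0 s, F₂ s u := by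
        have hm1 : Measurable fun s => ∫⁻ u in Ioo s t, F₁ s u := by
          have : (fun s => ∫⁻ u in Ioo s t, F₁ s u) = fun s => ∫⁻ u,
              {p : ℝ × ℝ | p.1 < p.2 ∧ p.2 < t}.indicator (Function.uncurry F₁) (s, u) := by
            ext s
            rw [← lintegral_indicator measurableSet_Ioo]
            congr 1
          rw [this]
          exact (hF₁m.indicator ((measurableSet_lt measurable_fst measurable_snd).inter
            (measurableSet_lt measurable_snd measurable_const))).lintegral_prod_right'
        have hm2 : Measurable fun s => ∫⁻ u in Ioo 0 s, F₂ s u := by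
          have : (fun s => ∫⁻ u in Ioo 0 s, F₂ s u) = fun s => ∫⁻ u,
              {p : ℝ × ℝ | 0 < p.2 ∧ p.2 < p.1}.indicator (Function.uncurry F₂) (s, u) := by
            ext s
            rw [← lintegral_indicator measurableSet_Ioo]
            congr 1
          rw [this]
          exact ((hF₂m.comp measurable_swap).indicator
            ((measurableSet_lt measurable_const measurable_snd).inter
            (measurableSet_lt measurable_snd measurable_fst))).lintegral_prod_right'
        rw [lintegral_add_left (hm1.const_mul _), lintegral_const_mul _ hm1,
          lintegral_const_mul _ hm2]
    _ ≤ ENNReal.ofReal (Lam α T g) * (ENNReal.ofReal (1 / α) * majorantConv α f t) +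
        ENNReal.ofReal (4 * Lam α T g) * (ENNReal.ofReal C * majorantConv α f t) := by
        gcongr
    _ = _ := by
        rw [← mul_assoc, ← mul_assoc, ← ENNReal.ofReal_mul hΛ, ← ENNReal.ofReal_mul (by positivity),
          ← add_mul, ← ENNReal.ofReal_add (by positivity) (by positivity)]
        congr 2
        ring

end DriverBound

end Stieltjes

/-! ### The exponent φ and Young's inequality. -/

namespace IsPhi

variable {γ α φ : ℝ}

lemma le_two_mul (h : IsPhi γ α φ) (hα : 0 < α) (hγ1 : γ ≤ 1) : φ ≤ 2 * α := by
  rcases hγ1.eq_or_lt with h1 | h1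
  · exact (h.1 h1).le
  · rcases le_or_gt ((1 - 2 * α) / (1 - α)) γ with h2 | h2
    · exact (h.2.1 h2 h1).2
    · rw [h.2.2 h2]; linarith

lemma lt_one (h : IsPhi γ α φ) (hα : 0 < α) (hα' : α < 1 / 2) (hγ1 : γ ≤ 1) : φ < 1 := by
  linarith [h.le_two_mul hα hγ1]

/-- This is the condition κ < 1 for the error exponent in `exists_young`. In the middle range it is
the lower bound on φ multiplied by γ; for small γ, where φ = α, it is the range condition on γ. -/
lemma two_mul_sub_lt (h : IsPhi γ α φ) (hα' : α < 1 / 2) (hγ1 : γ < 1) :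
    2 * α - φ * γ < 1 - γ := by
  have h1α : 0 < 1 - α := by linarith
  rcases le_or_gt ((1 - 2 * α) / (1 - α)) γ with h2 | h2
  · have hγ : 0 < γ := (div_pos (by linarith) h1α).trans_le h2
    have h3 := (h.2.1 h2 hγ1).1
    have h4 : (2 * α - 1) / γ < φ - 1 := by linarith
    rw [div_lt_iff₀ hγ] at h4
    linarith
  · rw [h.2.2 h2]
    rw [lt_div_iff₀ h1α] at h2
    linarith

/-- Ensures c^{α-1} ≤ c^{φ-1} for c ≥ 1, so that the fractional increments of the coefficient cost
no more than its size. -/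
lemma le (h : IsPhi γ α φ) (hα : 0 < α) (hα' : α < 1 / 2) (hγ1 : γ ≤ 1) : α ≤ φ := by
  have h1α : 0 < 1 - α := by linarith
  rcases hγ1.eq_or_lt with h1 | h1
  · rw [h.1 h1]; linarith
  · rcases le_or_gt ((1 - 2 * α) / (1 - α)) γ with h2 | h2
    · have hγ : 0 < γ := (div_pos (by linarith) h1α).trans_le h2
      have h3 := h.two_mul_sub_lt hα' h1
      rw [div_le_iff₀ h1α] at h2
      nlinarith
    · exact (h.2.2 h2).ge

/-- Young's inequality, which trades the singularity `q^{-2α}` for `q^{-φ}` at the cost of an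
integrable error. -/
lemma exists_young (h : IsPhi γ α φ) (hα : 0 < α) (hα' : α < 1 / 2) (hγ0 : 0 ≤ γ)
    (hγ1 : γ ≤ 1) :
    ∃ κ < (1 : ℝ), ∀ q X : ℝ, 0 < q → 0 ≤ X →
      q ^ (-(2 * α)) * X ^ γ ≤ q ^ (-φ) * X + q ^ (-κ) := by
  rcases hγ1.eq_or_lt with rfl | h1
  -- For γ = 1 there is nothing to trade, since φ = 2α; the error term is slack.
  · refine ⟨0, one_pos, fun q X hq hX => ?_⟩
    rw [h.1 rfl, Real.rpow_one]
    simp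
  · have h1γ : 0 < 1 - γ := by linarith
    -- With weights γ and 1-γ, homogeneity forces φγ + κ(1-γ) = 2α.
    refine ⟨(2 * α - φ * γ) / (1 - γ), ?_, fun q X hq hX => ?_⟩
    · rw [div_lt_one h1γ]
      exact h.two_mul_sub_lt hα' h1
    · have e1 : 0 ≤ q ^ (-φ) * X := by positivity
      have e2 : 0 ≤ q ^ (-((2 * α - φ * γ) / (1 - γ))) := by positivity
      have hy := Real.geom_mean_le_arith_mean2_weighted hγ0 h1γ.le e1 e2 (by ring)
      rw [Real.mul_rpow (by positivity) hX, ← Real.rpow_mul hq.le, ← Real.rpow_mul hq.le,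
        show -((2 * α - φ * γ) / (1 - γ)) * (1 - γ) = -(2 * α - φ * γ) by field_simp,
        mul_right_comm, ← Real.rpow_add hq,
        show -φ * γ + -(2 * α - φ * γ) = -(2 * α) by ring] at hy
      refine hy.trans ?_
      nlinarith

end IsPhi

/-! ### The convolution estimate with exponential weight. -/

lemma lintegral_ofReal_add_le {S : Set ℝ} {f g : ℝ → ℝ} {a b : ℝ} (hf : Measurable f)
    (hfa : ∫⁻ u in S, ENNReal.ofReal (f u) ≤ ENNReal.ofReal a)
    (hgb : ∫⁻ u in S, ENNReal.ofReal (g u) ≤ ENNReal.ofReal b) (ha : 0 ≤ a) (hb : 0 ≤ b) :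
    ∫⁻ u in S, ENNReal.ofReal (f u + g u) ≤ ENNReal.ofReal (a + b) := by
  rw [ENNReal.ofReal_add ha hb]
  refine (lintegral_mono fun u => ENNReal.ofReal_add_le).trans ?_
  rw [lintegral_add_left hf.ennreal_ofReal]
  exact add_le_add hfa hgb

lemma lintegral_ofReal_const_mul_le {S : Set ℝ} {f : ℝ → ℝ} {a k : ℝ} (hf : Measurable f)
    (hk : 0 ≤ k) (hfa : ∫⁻ u in S, ENNReal.ofReal (f u) ≤ ENNReal.ofReal a) :
    ∫⁻ u in S, ENNReal.ofReal (k * f u) ≤ ENNReal.ofReal (k * a) := by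
  rw [lintegral_const_mul_ofReal hk hf, ENNReal.ofReal_mul hk]
  gcongr

lemma lintegral_rpow_neg_le {t T p : ℝ} (ht : 0 ≤ t) (htT : t ≤ T) (hp : p < 1) :
    ∫⁻ u in Ioo 0 t, ENNReal.ofReal (u ^ (-p)) ≤ ENNReal.ofReal (T ^ (1 - p) / (1 - p)) := by
  have h := lintegral_sub_rpow_left ht hp
  simp only [sub_zero] at h
  rw [h]
  have : 0 < 1 - p := by linarith
  exact ENNReal.ofReal_le_ofReal (by gcongr)

lemma lintegral_sub_rpow_neg_le {t T p : ℝ} (ht : 0 ≤ t) (htT : t ≤ T) (hp : p < 1) :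
    ∫⁻ u in Ioo 0 t, ENNReal.ofReal ((t - u) ^ (-p))
      ≤ ENNReal.ofReal (T ^ (1 - p) / (1 - p)) := by
  rw [lintegral_sub_rpow_right ht hp, sub_zero]
  have : 0 < 1 - p := by linarith
  exact ENNReal.ofReal_le_ofReal (by gcongr)

lemma rpow_neg_mul_rpow_neg_le_add {a b p : ℝ} (ha : 0 < a) (hb : 0 < b) :
    a ^ (-p) * b ^ (-p) ≤ a ^ (-(2 * p)) + b ^ (-(2 * p)) := by
  have h : ∀ c : ℝ, 0 < c → c ^ (-(2 * p)) = c ^ (-p) * c ^ (-p) := fun c hc => by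
    rw [← Real.rpow_add hc]; congr 1; ring
  rw [h a ha, h b hb]
  nlinarith [sq_nonneg (a ^ (-p) - b ^ (-p)), mul_pos (Real.rpow_pos_of_pos ha (-p))
    (Real.rpow_pos_of_pos hb (-p))]

/-- The estimate of the convolution for integrands of growth `K (1 + X^γ)` and fractional
increments of growth `A + M X`, where `X = N e^{cu}`. -/
lemma exists_majorantConv_le {d m : ℕ} {T α γ φ K A M : ℝ} (hT : 0 < T) (hα : 0 < α)
    (hα' : α < 1 / 2) (hγ0 : 0 ≤ γ) (hγ1 : γ ≤ 1) (hφ : IsPhi γ α φ) (hK : 0 ≤ K) (hA : 0 ≤ A)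
    (hM : 0 ≤ M) :
    ∃ Ca Cb : ℝ, 0 ≤ Ca ∧ 0 ≤ Cb ∧ ∀ (f : ℝ → Mat d m) (c N t : ℝ), 1 ≤ c → 0 ≤ N →
      0 < t → t ≤ T →
      (∀ u ∈ Ioo 0 t, ‖f u‖ ≤ K * (1 + (N * Real.exp (c * u)) ^ γ)) →
      (∀ u ∈ Ioo 0 t, ∫⁻ v in Ioo 0 u, ENNReal.ofReal (‖f u - f v‖ / (u - v) ^ (α + 1))
        ≤ ENNReal.ofReal (A + M * (N * Real.exp (c * u)))) →
      majorantConv α f t ≤ ENNReal.ofReal (Ca + Cb * c ^ (φ - 1) * (N * Real.exp (c * t))) := by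
  obtain ⟨κ, hκ, hY⟩ := hφ.exists_young hα hα' hγ0 hγ1
  have hφ1 := hφ.lt_one hα hα' hγ1
  have hαφ := hφ.le hα hα' hγ1
  have p1 : 0 < 1 - 2 * α := by linarith
  have p2 : 0 < 1 - κ := by linarith
  have p3 : 0 < 1 - α := by linarith
  have p4 : 0 < 1 - φ := by linarith
  -- `Ca` sums the integrals of the five terms free of the exponential, `Cb` the coefficients of the
  -- three terms carrying it.
  refine ⟨K * (T ^ (1 - 2 * α) / (1 - 2 * α)) + (K * (T ^ (1 - κ) / (1 - κ)) +
      (K * (T ^ (1 - 2 * α) / (1 - 2 * α)) + (K * (T ^ (1 - κ) / (1 - κ)) +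
        A * (T ^ (1 - α) / (1 - α))))),
    K * (1 + 1 / (1 - φ)) + (K * (1 + 1 / (1 - φ)) + M * (1 + 1 / (1 - α))),
    by positivity, by positivity, ?_⟩
  intro f c N t hc hN ht htT hf1 hf2
  have hc0 : 0 < c := by linarith
  have hcα : c ^ (α - 1) ≤ c ^ (φ - 1) := Real.rpow_le_rpow_of_exponent_le hc (by linarith)
  -- The product u^{-α}(t-u)^{-α} is split into q^{-2α} with q = u and q = t-u. Each of these gives
  -- a constant part and, by Young, the exponents κ and φ; the fractional increments contribute the
  -- two terms with (t-u)^{-α}.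
  have hpt : ∀ u ∈ Ioo 0 t, weylMajorant α f u * ENNReal.ofReal ((t - u) ^ (-α)) ≤
      ENNReal.ofReal (K * u ^ (-(2 * α)) + (K * u ^ (-κ) + (K * (t - u) ^ (-(2 * α)) +
        (K * (t - u) ^ (-κ) + (A * (t - u) ^ (-α) +
          ((K * N) * (Real.exp (c * u) * u ^ (-φ)) +
            ((K * N) * (Real.exp (c * u) * (t - u) ^ (-φ)) +
              (M * N) * (Real.exp (c * u) * (t - u) ^ (-α))))))))) := by
    intro u hu
    have hu0 : 0 < u := hu.1
    have htu : 0 < t - u := by linarith [hu.2]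
    set X := N * Real.exp (c * u) with hX
    have hX0 : 0 ≤ X := by positivity
    have hXγ : 0 ≤ X ^ γ := by positivity
    have e1 : weylMajorant α f u ≤
        ENNReal.ofReal (K * (1 + X ^ γ) * u ^ (-α) + (A + M * X)) := by
      rw [ENNReal.ofReal_add (by positivity) (by positivity)]
      refine add_le_add ?_ (hf2 u hu)
      rw [ENNReal.ofReal_mul (by positivity), ← ofReal_norm]
      gcongr
      exact hf1 u hu
    refine (mul_le_mul_left e1 _).trans ?_
    rw [← ENNReal.ofReal_mul (by positivity)]
    apply ENNReal.ofReal_le_ofReal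
    have y1 := mul_le_mul_of_nonneg_left (hY u X hu0 hX0) hK
    have y2 := mul_le_mul_of_nonneg_left (hY (t - u) X htu hX0) hK
    have y3 := mul_le_mul_of_nonneg_left (rpow_neg_mul_rpow_neg_le_add (p := α) hu0 htu)
      (show 0 ≤ K * (1 + X ^ γ) by positivity)
    rw [mul_assoc K N, mul_assoc K N, mul_assoc M N, ← mul_assoc N, ← mul_assoc N,
      ← mul_assoc N, ← hX]
    linarith
  have k1 := lintegral_rpow_neg_le ht.le htT (show 2 * α < 1 by linarith)
  have k2 := lintegral_rpow_neg_le ht.le htT hκ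
  have k3 := lintegral_sub_rpow_neg_le ht.le htT (show 2 * α < 1 by linarith)
  have k4 := lintegral_sub_rpow_neg_le ht.le htT hκ
  have k5 := lintegral_sub_rpow_neg_le ht.le htT (show α < 1 by linarith)
  have k6 := lintegral_exp_mul_rpow_neg_left hc0 (show 0 ≤ φ by linarith) hφ1 ht.le
  have k7 := lintegral_exp_mul_rpow_neg_right hc0 (show 0 ≤ φ by linarith) hφ1 ht.le
  have k8 := lintegral_exp_mul_rpow_neg_right hc0 hα.le (show α < 1 by linarith) ht.le
  refine (setLIntegral_mono' measurableSet_Ioo hpt).trans ?_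
  have hKN : 0 ≤ K * N := by positivity
  have hMN : 0 ≤ M * N := by positivity
  refine (lintegral_ofReal_add_le (by fun_prop)
    (lintegral_ofReal_const_mul_le (by fun_prop) hK k1)
    (lintegral_ofReal_add_le (by fun_prop)
    (lintegral_ofReal_const_mul_le (by fun_prop) hK k2)
    (lintegral_ofReal_add_le (by fun_prop)
    (lintegral_ofReal_const_mul_le (by fun_prop) hK k3)
    (lintegral_ofReal_add_le (by fun_prop)
    (lintegral_ofReal_const_mul_le (by fun_prop) hK k4)
    (lintegral_ofReal_add_le (by fun_prop)
    (lintegral_ofReal_const_mul_le (by fun_prop) hA k5)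
    (lintegral_ofReal_add_le (by fun_prop)
    (lintegral_ofReal_const_mul_le (by fun_prop) hKN k6)
    (lintegral_ofReal_add_le (by fun_prop)
    (lintegral_ofReal_const_mul_le (by fun_prop) hKN k7)
    (lintegral_ofReal_const_mul_le (by fun_prop) hMN k8)
    ?_ ?_) ?_ ?_) ?_ ?_) ?_ ?_) ?_ ?_) ?_ ?_) ?_ ?_).trans (ENNReal.ofReal_le_ofReal ?_)
  all_goals try positivity
  have hx : M * N * ((1 + 1 / (1 - α)) * c ^ (α - 1) * Real.exp (c * t))
      ≤ M * N * ((1 + 1 / (1 - α)) * c ^ (φ - 1) * Real.exp (c * t)) := by gcongr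
  nlinarith

/-- The pointwise quantity whose supremum is `wNorm`. -/
noncomputable def pathNorm {E : Type*} [NormedAddCommGroup E] (α a : ℝ) (x : ℝ → E) (t : ℝ) :
    ℝ≥0∞ :=
  ‖x t‖ₑ + ∫⁻ s in Ioo a t, ENNReal.ofReal (‖x t - x s‖ / (t - s) ^ (α + 1))

/-! ### The delayed diffusion coefficient along a path. -/

section Diffusion

variable {d m : ℕ} {α β δ r T M₀ : ℝ} {σ : ℝ → Vec d → Mat d m} {x : ℝ → Vec d}

lemma H1.norm_sub_le (h : H1 T β δ M₀ σ) {t s : ℝ} (ht : t ∈ Icc 0 T) (hs : s ∈ Icc 0 T)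
    (y z : Vec d) : ‖σ t y - σ s z‖ ≤ M₀ * |t - s| ^ β + M₀ * ‖y - z‖ := by
  have h1 : ‖σ t y - σ s y‖ ≤ M₀ * |t - s| ^ β := by
    -- `time_holder` is quantified over `i : Fin d`, hence vacuous for d = 0, where however the
    -- target space is trivial.
    rcases Nat.eq_zero_or_pos d with rfl | hd
    · rw [Subsingleton.elim (σ t y) (σ s y), sub_self, norm_zero]
      have := h.const_pos
      positivity
    · exact (le_add_of_nonneg_right (norm_nonneg _)).trans (h.time_holder t ht s hs y ⟨0, hd⟩)
  calc ‖σ t y - σ s z‖ = ‖(σ t y - σ s y) + (σ s y - σ s z)‖ := by rw [sub_add_sub_cancel]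
    _ ≤ _ := (norm_add_le _ _).trans (add_le_add h1 (h.lip s hs y z))

lemma H1.continuousOn_comp (h : H1 T β δ M₀ σ) (hr : 0 < r)
    (hx : ContinuousOn x (Icc (-r) T)) :
    ContinuousOn (fun s => σ s (x (s - r))) (Icc 0 T) := by
  have hxr : ContinuousOn (fun s => x (s - r)) (Icc 0 T) := by
    refine hx.comp (by fun_prop) fun s hs => ?_
    exact ⟨by linarith [hs.1], by linarith [hs.2]⟩
  intro s hs
  have h1 : Tendsto (fun t => M₀ * |t - s| ^ β + M₀ * ‖x (t - r) - x (s - r)‖)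
      (𝓝[Icc 0 T] s) (𝓝 0) := by
    have e1 : Continuous fun t : ℝ => M₀ * |t - s| ^ β := by
      have : Continuous fun t : ℝ => |t - s| ^ β :=
        Continuous.rpow_const (by fun_prop) fun _ => Or.inr h.beta_pos.le
      fun_prop
    have e2 := ((hxr s hs).tendsto.sub_const (x (s - r))).norm.const_mul M₀
    have := ((e1.tendsto s).mono_left nhdsWithin_le_nhds).add e2
    simpa [Real.zero_rpow h.beta_pos.ne'] using this
  refine tendsto_iff_norm_sub_tendsto_zero.2
    (squeeze_zero' (Eventually.of_forall fun _ => norm_nonneg _) ?_ h1)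
  filter_upwards [self_mem_nhdsWithin] with t ht
  exact h.norm_sub_le ht hs _ _

lemma setLIntegral_comp_sub_right (F : ℝ → ℝ≥0∞) (a b r : ℝ) :
    ∫⁻ v in Ioo a b, F (v - r) = ∫⁻ v in Ioo (a - r) (b - r), F v := by
  have := (measurePreserving_sub_right (volume : Measure ℝ) r).setLIntegral_comp_preimage_emb
    (MeasurableEquiv.subRight r).measurableEmbedding F (Ioo (a - r) (b - r))
  rw [← this]
  simp

/-- Fractional increments of the delayed diffusion coefficient along a path. -/
lemma H1.lintegral_comp_le (h : H1 T β δ M₀ σ) (hαβ : α < β) {u : ℝ}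
    (hu : 0 < u) (huT : u ≤ T) :
    ∫⁻ v in Ioo 0 u,
        ENNReal.ofReal (‖σ u (x (u - r)) - σ v (x (v - r))‖ / (u - v) ^ (α + 1))
      ≤ ENNReal.ofReal (M₀ * (T ^ (β - α) / (β - α))) +
        ENNReal.ofReal M₀ * pathNorm α (-r) x (u - r) := by
  have hM := h.const_pos.le
  calc _ ≤ ∫⁻ v in Ioo 0 u, (ENNReal.ofReal (M₀ * (u - v) ^ (-(1 + α - β))) +
        ENNReal.ofReal M₀ *
          ENNReal.ofReal (‖x (u - r) - x (v - r)‖ / (u - r - (v - r)) ^ (α + 1))) := by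
        refine setLIntegral_mono' measurableSet_Ioo fun v hv => ?_
        have huv : 0 < u - v := by linarith [hv.2]
        rw [← ENNReal.ofReal_mul hM, sub_sub_sub_cancel_right,
          ← ENNReal.ofReal_add (by positivity) (by positivity)]
        apply ENNReal.ofReal_le_ofReal
        rw [div_le_iff₀ (by positivity)]
        refine (h.norm_sub_le ⟨hu.le, huT⟩ ⟨hv.1.le, hv.2.le.trans huT⟩ _ _).trans_eq ?_
        rw [abs_of_pos huv, add_mul, mul_assoc, ← Real.rpow_add huv, mul_assoc,
          div_mul_cancel₀ _ (by positivity)]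
        congr 3
        ring
    _ ≤ _ := by
        rw [lintegral_add_left (by fun_prop), lintegral_const_mul' _ _ ENNReal.ofReal_ne_top]
        refine add_le_add ?_ ?_
        · refine lintegral_ofReal_const_mul_le (by fun_prop) hM ?_
          have := lintegral_sub_rpow_neg_le hu.le huT (show 1 + α - β < 1 by linarith)
          rwa [show 1 - (1 + α - β) = β - α by ring] at this
        · rw [setLIntegral_comp_sub_right
            (fun v => ENNReal.ofReal (‖x (u - r) - x v‖ / (u - r - v) ^ (α + 1))), zero_sub]
          gcongr
          exact le_add_self

end Diffusion

/-! ### The hereditary drift along a path. -/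

section Drift

variable {d : ℕ} {r T α L₀ B : ℝ} {b₀ : ℝ → ℝ} {b : ℝ → C(Icc (-r) T, Vec d) → Vec d}

lemma supUpTo_le {a c : ℝ} {f : C(Icc a c, Vec d)} {t K : ℝ} (hK : 0 ≤ K)
    (hf : ∀ s : Icc a c, (s : ℝ) ≤ t → ‖f s‖ ≤ K) : supUpTo f t ≤ K := by
  refine Real.sSup_le ?_ hK
  rintro _ ⟨s, hs, rfl⟩
  exact hf s hs

lemma H2.integrableOn {ρ : ℝ} (h : H2 r T ρ L₀ b₀ b) (hT : 0 < T) (X : C(Icc (-r) T, Vec d)) :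
    IntegrableOn (fun s => b s X) (Icc 0 T) := by
  have hm : Measurable fun s : Icc (0 : ℝ) T => b s X :=
    letI : MeasurableSpace C(Icc (-r) T, Vec d) := borel _
    h.meas.comp (g := fun p : Icc (0 : ℝ) T × C(Icc (-r) T, Vec d) => b p.1 p.2)
      (measurable_id.prodMk measurable_const)
  have hE : Measurable (IccExtend hT.le fun s : Icc (0 : ℝ) T => b s X) :=
    hm.comp continuous_projIcc.measurable
  have hb0 : IntegrableOn b₀ (Icc 0 T) :=
    h.memLp.integrable (by
      rw [← ENNReal.ofReal_one]
      exact ENNReal.ofReal_le_ofReal (by linarith [h.rho_ge]))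
  refine Integrable.mono' (g := fun s => L₀ * ‖X‖ + b₀ s) ?_ ?_ ?_
  · exact (integrable_const (μ := volume.restrict (Icc 0 T)) _).add hb0
  · refine hE.aestronglyMeasurable.congr ?_
    filter_upwards [ae_restrict_mem measurableSet_Icc] with s hs
    rw [IccExtend_of_mem _ _ hs]
  · filter_upwards [ae_restrict_mem measurableSet_Icc] with s hs
    refine (h.growth X s hs).trans ?_
    have := h.const_pos
    gcongr
    exact supUpTo_le (norm_nonneg _) fun s _ => X.norm_coe_le_norm s

/-- Hölder continuity of the drift part along a path with `|X(s)| ≤ N e^{cs}`. -/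
lemma H2.enorm_drift_sub_le (h : H2 r T (1 / α) L₀ b₀ b) (hT : 0 < T) (hα : 0 < α)
    (hα' : α < 1 / 2)
    (hB : (eLpNorm b₀ (ENNReal.ofReal (1 / α)) (volume.restrict (Icc 0 T))).toReal ≤ B)
    {X : C(Icc (-r) T, Vec d)} {c N : ℝ} (hc : 0 < c) (hN : 0 ≤ N)
    (hX : ∀ s : Icc (-r) T, ‖X s‖ ≤ N * Real.exp (c * max (s : ℝ) 0)) {s t : ℝ} (hs : 0 ≤ s)
    (hst : s ≤ t) (htT : t ≤ T) :
    ‖(∫ u in Ioo 0 t, b u X) - ∫ u in Ioo 0 s, b u X‖ₑ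
      ≤ ENNReal.ofReal ((L₀ * c ^ (-α) * (N * Real.exp (c * t)) + B) * (t - s) ^ (1 - α)) := by
  have hL := h.const_pos
  have hB0 : 0 ≤ B := ENNReal.toReal_nonneg.trans hB
  have hint := h.integrableOn hT X
  have heq : (∫ u in Ioo 0 t, b u X) - ∫ u in Ioo 0 s, b u X = ∫ u in Ioo s t, b u X := by
    have e : ∀ v ∈ Icc 0 T, IntervalIntegrable (fun u => b u X) volume 0 v := fun v hv =>
      (intervalIntegrable_iff_integrableOn_Ioc_of_le hv.1).2
        (hint.mono_set fun u hu => ⟨hu.1.le, hu.2.trans hv.2⟩)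
    have := intervalIntegral.integral_interval_sub_left (e t ⟨hs.trans hst, htT⟩)
      (e s ⟨hs, hst.trans htT⟩)
    rwa [intervalIntegral.integral_of_le hs, intervalIntegral.integral_of_le hst,
      intervalIntegral.integral_of_le (hs.trans hst), integral_Ioc_eq_integral_Ioo,
      integral_Ioc_eq_integral_Ioo, integral_Ioc_eq_integral_Ioo] at this
  have hsub : Ioo s t ⊆ Icc 0 T := fun u hu => ⟨hs.trans hu.1.le, hu.2.le.trans htT⟩
  have hpt : ∀ u ∈ Ioo s t,
      ‖b u X‖ₑ ≤ ENNReal.ofReal ((L₀ * N) * Real.exp (c * u)) + ‖b₀ u‖ₑ := by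
    intro u hu
    rw [← ofReal_norm, ← ofReal_norm, ← ENNReal.ofReal_add (by positivity) (by positivity)]
    apply ENNReal.ofReal_le_ofReal
    refine (h.growth X u (hsub hu)).trans (add_le_add ?_ (le_abs_self _))
    rw [mul_assoc]
    gcongr
    refine supUpTo_le (by positivity) fun v hv => (hX v).trans ?_
    have : max (v : ℝ) 0 ≤ u := max_le hv (hsub hu).1
    gcongr
  have hexp : ∫⁻ u in Ioo s t, ENNReal.ofReal (Real.exp (c * u))
      ≤ ENNReal.ofReal (Real.exp (c * t) * ((t - s) ^ (1 - α) * c ^ (-α))) := by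
    rw [lintegral_Ioo_eq_ofReal_intervalIntegral hst
      ((by fun_prop : Continuous fun u => Real.exp (c * u)).intervalIntegrable _ _)
      (fun u _ => (Real.exp_pos _).le)]
    apply ENNReal.ofReal_le_ofReal
    have := integral_exp_mul_le hc hst (θ := 1 - α) (by linarith) (by linarith)
    rwa [show 1 - α - 1 = -α by ring] at this
  -- Hölder's inequality with exponents 1/α and 1/(1-α): the integrability of b₀ matches the
  -- exponent 1-α.
  have hb0 : ∫⁻ u in Ioo s t, ‖b₀ u‖ₑ ≤ ENNReal.ofReal (B * (t - s) ^ (1 - α)) := by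
    have hq : (1 : ℝ≥0∞) ≤ ENNReal.ofReal (1 / α) := by
      rw [← ENNReal.ofReal_one]
      exact ENNReal.ofReal_le_ofReal (by linarith [h.rho_ge])
    have h1 := eLpNorm_le_eLpNorm_mul_rpow_measure_univ (μ := volume.restrict (Ioo s t)) hq
      (h.memLp.aestronglyMeasurable.mono_measure (Measure.restrict_mono hsub le_rfl))
    rw [eLpNorm_one_eq_lintegral_enorm] at h1
    refine h1.trans ?_
    rw [ENNReal.ofReal_mul hB0]
    have hts : 0 ≤ t - s := by linarith
    refine mul_le_mul' ?_ (le_of_eq ?_)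
    · refine (eLpNorm_mono_measure _ (Measure.restrict_mono hsub le_rfl)).trans ?_
      rw [← ENNReal.ofReal_toReal h.memLp.eLpNorm_ne_top]
      exact ENNReal.ofReal_le_ofReal hB
    · rw [Measure.restrict_apply_univ, Real.volume_Ioo,
        ENNReal.ofReal_rpow_of_nonneg hts]
      · congr 2
        rw [ENNReal.toReal_ofReal (by positivity)]
        simp
      · rw [ENNReal.toReal_ofReal (by positivity)]
        simp only [ENNReal.toReal_one, one_div, div_one, inv_inv]
        linarith
  rw [heq]
  refine (enorm_integral_le_lintegral_enorm _).trans
    ((setLIntegral_mono' measurableSet_Ioo hpt).trans ?_)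
  rw [lintegral_add_left (by fun_prop)]
  have hts : 0 ≤ (t - s) ^ (1 - α) := Real.rpow_nonneg (by linarith) _
  refine (add_le_add (lintegral_ofReal_const_mul_le (by fun_prop) (by positivity) hexp)
    hb0).trans (le_of_eq ?_)
  rw [← ENNReal.ofReal_add (by positivity) (by positivity)]
  congr 1
  ring

end Drift

/-! ### The path norm of a solution. -/

/-- Allows the coefficient, continuous only on [0,T], to be replaced by a continuous extension to
the line, as the measurability lemmas require. -/
lemma stieltjes_congr {d m : ℕ} {α T t : ℝ} {f f' : ℝ → Mat d m} (g : ℝ → Vec m)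
    (h : EqOn f f' (Icc 0 T)) (htT : t ≤ T) : stieltjes α f g t = stieltjes α f' g t := by
  refine setIntegral_congr_fun measurableSet_Ioo fun u hu => ?_
  have hu' : u ∈ Icc 0 T := ⟨hu.1.le, hu.2.le.trans htT⟩
  have hw : weylLeft α f u = weylLeft α f' u := by
    unfold weylLeft
    rw [h hu']
    congr 3
    refine setIntegral_congr_fun measurableSet_Ioo fun v hv => ?_
    rw [h ⟨hv.1.le, hv.2.le.trans hu'.2⟩]
  rw [hw]

lemma enorm_le_pathNorm {E : Type*} [NormedAddCommGroup E] (α a : ℝ) (x : ℝ → E) (t : ℝ) :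
    ‖x t‖ₑ ≤ pathNorm α a x t :=
  le_self_add

lemma pathNorm_congr {E : Type*} [NormedAddCommGroup E] {α a t : ℝ} {x y : ℝ → E} (hat : a ≤ t)
    (h : EqOn x y (Icc a t)) : pathNorm α a x t = pathNorm α a y t := by
  unfold pathNorm
  rw [h (right_mem_Icc.2 hat)]
  congr 1
  refine setLIntegral_congr_fun measurableSet_Ioo fun s hs => ?_
  rw [h ⟨hs.1.le, hs.2.le⟩]

lemma pathNorm_le_wNorm {E : Type*} [NormedAddCommGroup E] {α a b t : ℝ} (x : ℝ → E)
    (ht : t ∈ Icc a b) : pathNorm α a x t ≤ wNorm α a b x :=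
  le_iSup₂_of_le t ht le_rfl

/-- The norm at a positive time, split at the origin. -/
lemma pathNorm_le_of_increments {E : Type*} [NormedAddCommGroup E] {α r t : ℝ} {x : ℝ → E}
    {P Q : ℝ≥0∞} (hα : 0 < α) (hr : 0 < r) (ht : 0 < t)
    (hP : ENNReal.ofReal (t ^ (-α)) * ‖x t - x 0‖ₑ ≤ P)
    (hQ : ∫⁻ s in Ioo 0 t, ENNReal.ofReal ((t - s) ^ (-α - 1)) * ‖x t - x s‖ₑ ≤ Q) :
    pathNorm α (-r) x t
      ≤ pathNorm α (-r) x 0 + ENNReal.ofReal (t ^ α + 1 / α) * P + Q := by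
  have h1 : ‖x t‖ₑ ≤ ‖x 0‖ₑ + ENNReal.ofReal (t ^ α) * P := by
    calc ‖x t‖ₑ = ‖x 0 + (x t - x 0)‖ₑ := by rw [add_sub_cancel]
      _ ≤ ‖x 0‖ₑ + ‖x t - x 0‖ₑ := enorm_add_le _ _
      _ = ‖x 0‖ₑ + ENNReal.ofReal (t ^ α) * (ENNReal.ofReal (t ^ (-α)) * ‖x t - x 0‖ₑ) := by
        rw [← mul_assoc, ← ENNReal.ofReal_mul (by positivity), ← Real.rpow_add ht]
        simp
      _ ≤ _ := by gcongr
  -- For s < 0 one passes through x(0). Since t-s ≥ 0-s, one part is dominated by the integral in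
  -- the path norm at 0; the other has kernel mass at most t^{-α}/α, whatever r is.
  have h2 : ∫⁻ s in Ioo (-r) 0, ENNReal.ofReal (‖x t - x s‖ / (t - s) ^ (α + 1))
      ≤ ENNReal.ofReal (1 / α) * P +
        ∫⁻ s in Ioo (-r) 0, ENNReal.ofReal (‖x 0 - x s‖ / (0 - s) ^ (α + 1)) := by
    calc _ ≤ ∫⁻ s in Ioo (-r) 0, (ENNReal.ofReal ((t - s) ^ (-α - 1)) * ‖x t - x 0‖ₑ +
          ENNReal.ofReal (‖x 0 - x s‖ / (0 - s) ^ (α + 1))) := by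
          refine setLIntegral_mono' measurableSet_Ioo fun s hs => ?_
          have hs0 : 0 < 0 - s := by linarith [hs.2]
          have hts : 0 < t - s := by linarith
          rw [← ofReal_norm, ← ENNReal.ofReal_mul (by positivity),
            ← ENNReal.ofReal_add (by positivity) (by positivity)]
          apply ENNReal.ofReal_le_ofReal
          rw [show -α - 1 = -(α + 1) by ring, Real.rpow_neg hts.le, ← div_eq_inv_mul]
          calc ‖x t - x s‖ / (t - s) ^ (α + 1)
              ≤ (‖x t - x 0‖ + ‖x 0 - x s‖) / (t - s) ^ (α + 1) := by
                gcongr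
                exact norm_sub_le_norm_sub_add_norm_sub _ _ _
            _ = ‖x t - x 0‖ / (t - s) ^ (α + 1) + ‖x 0 - x s‖ / (t - s) ^ (α + 1) := add_div _ _ _
            _ ≤ _ := by gcongr
      _ ≤ _ := by
          rw [lintegral_add_left (by fun_prop), lintegral_mul_const _ (by fun_prop)]
          refine add_le_add ?_ le_rfl
          calc _ ≤ ENNReal.ofReal ((t - 0) ^ (-α) / α) * ‖x t - x 0‖ₑ := by
                gcongr
                exact lintegral_sub_rpow_neg_one_sub hα (by linarith) ht
            _ = ENNReal.ofReal (1 / α) * (ENNReal.ofReal (t ^ (-α)) * ‖x t - x 0‖ₑ) := by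
                rw [← mul_assoc, ← ENNReal.ofReal_mul (by positivity), sub_zero]
                congr 2
                ring
            _ ≤ _ := by gcongr
  have h3 : ∫⁻ s in Ioo (-r) t, ENNReal.ofReal (‖x t - x s‖ / (t - s) ^ (α + 1))
      = (∫⁻ s in Ioo (-r) 0, ENNReal.ofReal (‖x t - x s‖ / (t - s) ^ (α + 1))) +
        ∫⁻ s in Ioo 0 t, ENNReal.ofReal ((t - s) ^ (-α - 1)) * ‖x t - x s‖ₑ := by
    have hdisj : Disjoint (Ioc (-r) 0) (Ioo 0 t) :=
      disjoint_left.2 fun u h1 h2 => absurd h1.2 (not_le.2 h2.1)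
    rw [← Ioc_union_Ioo_eq_Ioo (by linarith : -r ≤ 0) ht, lintegral_union measurableSet_Ioo hdisj,
      setLIntegral_congr Ioo_ae_eq_Ioc.symm]
    congr 1
    refine setLIntegral_congr_fun measurableSet_Ioo fun s hs => ?_
    have hts : 0 < t - s := by linarith [hs.2]
    rw [← ofReal_norm, ← ENNReal.ofReal_mul (by positivity), show -α - 1 = -(α + 1) by ring,
      Real.rpow_neg hts.le, ← div_eq_inv_mul]
  unfold pathNorm
  rw [h3, ENNReal.ofReal_add (by positivity) (by positivity)]
  calc _ ≤ (‖x 0‖ₑ + ENNReal.ofReal (t ^ α) * P) + ((ENNReal.ofReal (1 / α) * P +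
        ∫⁻ s in Ioo (-r) 0, ENNReal.ofReal (‖x 0 - x s‖ / (0 - s) ^ (α + 1))) + Q) := by
        gcongr
    _ = _ := by ring

lemma Lam_nonneg {E : Type*} [NormedAddCommGroup E] [NormedSpace ℝ E] {α : ℝ} (hα1 : α < 1)
    (T : ℝ) (g : ℝ → E) : 0 ≤ Lam α T g :=
  mul_nonneg (inv_nonneg.2 (Real.Gamma_pos_of_pos (by linarith)).le) ENNReal.toReal_nonneg

/-- The path norm of a solution in terms of a Hölder bound `D` for its drift and a bound `j` for
the convolution of its diffusion coefficient. -/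
lemma IsSolution.pathNorm_le {d m : ℕ} {α r T D D' j t : ℝ}
    {b : ℝ → C(Icc (-r) T, Vec d) → Vec d} {σ : ℝ → Vec d → Mat d m} {g : ℝ → Vec m}
    {η x : ℝ → Vec d} (hx : IsSolution α r T b σ g η x) (hg : DriverBound α T D' g)
    (hα : 0 < α) (hα' : α < 1 / 2) (hr : 0 < r) (hT : 0 < T) (ht : t ∈ Ioc 0 T) (hD : 0 ≤ D)
    (hj : 0 ≤ j) {f : ℝ → Mat d m} (hf : Continuous f)
    (hfeq : EqOn (fun s => σ s (x (s - r))) f (Icc 0 T))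
    (hJ : majorantConv α f t ≤ ENNReal.ofReal j)
    (hdrift : ∀ s, 0 ≤ s → s ≤ t →
      ‖(∫ u in Ioo 0 t, b u ⟨(Icc (-r) T).domRestrict x, hx.cont.domRestrict⟩)
        - ∫ u in Ioo 0 s, b u ⟨(Icc (-r) T).domRestrict x, hx.cont.domRestrict⟩‖ₑ
        ≤ ENNReal.ofReal (D * (t - s) ^ (1 - α))) :
    pathNorm α (-r) x t ≤ pathNorm α (-r) x 0 +
      ENNReal.ofReal ((T ^ α + 1 / α) * (D * T ^ (1 - 2 * α) + Lam α T g * j)) +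
      ENNReal.ofReal (D * (T ^ (1 - 2 * α) / (1 - 2 * α)) + Lam α T g *
        (1 / α + 4 * (2 ^ (2 * α) / α + 2 ^ (1 - α) / (1 - 2 * α))) * j) := by
  have hα1 : α < 1 := by linarith
  have p1 : 0 < 1 - 2 * α := by linarith
  have hΛ := Lam_nonneg hα1 T g
  have ht0 : 0 < t := ht.1
  generalize hI : (fun s => ∫ u in Ioo 0 s,
    b u ⟨(Icc (-r) T).domRestrict x, hx.cont.domRestrict⟩) = I
  have hIs : ∀ s, ∫ u in Ioo 0 s, b u ⟨(Icc (-r) T).domRestrict x, hx.cont.domRestrict⟩ = I s :=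
    fun s => congrFun hI s
  have hI0 : I 0 = 0 := by rw [← hIs]; simp
  have heqn : ∀ s ∈ Ioc 0 T, x s = x 0 + I s + stieltjes α f g s := by
    intro s hs
    rw [hx.eqn s hs, hx.init 0 ⟨by linarith, le_rfl⟩, stieltjes_congr g hfeq hs.2, hIs]
  simp only [hIs] at hdrift
  have hJfin : majorantConv α f t ≠ ∞ := ne_top_of_le_ne_top ENNReal.ofReal_ne_top hJ
  have hP : ENNReal.ofReal (t ^ (-α)) * ‖x t - x 0‖ₑ
      ≤ ENNReal.ofReal (D * T ^ (1 - 2 * α) + Lam α T g * j) := by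
    have e0 : x t - x 0 = (I t - I 0) + stieltjes α f g t := by
      rw [heqn t ht, hI0]
      abel
    have ep : t ^ (-α) * (D * (t - 0) ^ (1 - α)) ≤ D * T ^ (1 - 2 * α) := by
      rw [sub_zero, mul_left_comm, ← Real.rpow_add ht0, show -α + (1 - α) = 1 - 2 * α by ring]
      have := ht.2
      gcongr
    rw [e0, ENNReal.ofReal_add (by positivity) (by positivity), ENNReal.ofReal_mul hΛ]
    refine (mul_le_mul_right (enorm_add_le _ _) _).trans ?_
    rw [mul_add]
    refine add_le_add ?_ ?_
    · refine (mul_le_mul_right (hdrift 0 le_rfl ht0.le) _).trans ?_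
      rw [← ENNReal.ofReal_mul (by positivity)]
      exact ENNReal.ofReal_le_ofReal ep
    · refine (hg.rpow_mul_enorm_stieltjes_le hα hα1 hf ht).trans ?_
      gcongr
  have hQ : ∫⁻ s in Ioo 0 t, ENNReal.ofReal ((t - s) ^ (-α - 1)) * ‖x t - x s‖ₑ
      ≤ ENNReal.ofReal (D * (T ^ (1 - 2 * α) / (1 - 2 * α)) + Lam α T g *
        (1 / α + 4 * (2 ^ (2 * α) / α + 2 ^ (1 - α) / (1 - 2 * α))) * j) := by
    calc _ ≤ ∫⁻ s in Ioo 0 t, (ENNReal.ofReal (D * (t - s) ^ (-(2 * α))) +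
          ENNReal.ofReal ((t - s) ^ (-α - 1)) * ‖stieltjes α f g t - stieltjes α f g s‖ₑ) := by
          refine setLIntegral_mono' measurableSet_Ioo fun s hs => ?_
          have hts : 0 < t - s := by linarith [hs.2]
          have e0 : x t - x s = (I t - I s) + (stieltjes α f g t - stieltjes α f g s) := by
            rw [heqn t ht, heqn s ⟨hs.1, hs.2.le.trans ht.2⟩]
            abel
          rw [e0]
          refine (mul_le_mul_right (enorm_add_le _ _) _).trans ?_
          rw [mul_add]
          refine add_le_add ?_ le_rfl
          refine (mul_le_mul_right (hdrift s hs.1.le hs.2.le) _).trans (le_of_eq ?_)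
          rw [← ENNReal.ofReal_mul (by positivity), mul_left_comm, ← Real.rpow_add hts,
            show -α - 1 + (1 - α) = -(2 * α) by ring]
      _ ≤ _ := by
          rw [lintegral_add_left (by fun_prop),
            ENNReal.ofReal_add (by positivity) (by positivity)]
          refine add_le_add (lintegral_ofReal_const_mul_le (by fun_prop) hD
            (lintegral_sub_rpow_neg_le ht0.le ht.2 (by linarith))) ?_
          refine (hg.lintegral_stieltjes_sub_le hα hα' hf ht hJfin).trans ?_
          rw [ENNReal.ofReal_mul (q := j) (by positivity)]
          exact mul_le_mul_right hJ _
  refine (pathNorm_le_of_increments hα hr ht0 hP hQ).trans ?_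
  have htα : t ^ α ≤ T ^ α := Real.rpow_le_rpow ht0.le ht.2 hα.le
  rw [ENNReal.ofReal_mul (by positivity)]
  gcongr

/-- A delayed diffusion coefficient along a path `x` with `pathNorm` at most `N e^{cu}`. -/
lemma H1.lintegral_comp_le_exp {d m : ℕ} {α β δ r T M₀ c N u : ℝ} {σ : ℝ → Vec d → Mat d m}
    {x : ℝ → Vec d} (h1 : H1 T β δ M₀ σ) (hT : 0 < T) (hr : 0 < r) (hαβ : α < β) (hc : 0 ≤ c)
    (hN : 0 ≤ N) (hb : ∀ u ∈ Icc (-r) T,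
      pathNorm α (-r) x u ≤ ENNReal.ofReal (N * Real.exp (c * max u 0)))
    (hu : 0 < u) (huT : u ≤ T) :
    ∫⁻ v in Ioo 0 u,
        ENNReal.ofReal (‖σ u (x (u - r)) - σ v (x (v - r))‖ / (u - v) ^ (α + 1))
      ≤ ENNReal.ofReal (M₀ * (T ^ (β - α) / (β - α)) + M₀ * (N * Real.exp (c * u))) := by
  have hM := h1.const_pos.le
  have p3 : 0 < β - α := by linarith
  rw [ENNReal.ofReal_add (by positivity) (by positivity), ENNReal.ofReal_mul (q := N * _) hM]
  refine (h1.lintegral_comp_le hαβ hu huT).trans (add_le_add le_rfl (mul_le_mul_right ?_ _))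
  refine (hb _ ⟨by linarith, by linarith⟩).trans (ENNReal.ofReal_le_ofReal ?_)
  have : max (u - r) 0 ≤ u := max_le (by linarith) hu.le
  gcongr

lemma norm_le_of_pathNorm_le {E : Type*} [NormedAddCommGroup E] {α a t K : ℝ} {x : ℝ → E}
    (hK : 0 ≤ K) (h : pathNorm α a x t ≤ ENNReal.ofReal K) : ‖x t‖ ≤ K := by
  have := (enorm_le_pathNorm α a x t).trans h
  rwa [← ofReal_norm, ENNReal.ofReal_le_ofReal_iff hK] at this

/-- Hölder continuity of the drift part of a solution. -/
lemma IsSolution.enorm_drift_sub_le {d m : ℕ} {α r T L₀ B c N t : ℝ} {b₀ : ℝ → ℝ}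
    {b : ℝ → C(Icc (-r) T, Vec d) → Vec d} {σ : ℝ → Vec d → Mat d m} {g : ℝ → Vec m}
    {η x : ℝ → Vec d} (hx : IsSolution α r T b σ g η x) (h2 : H2 r T (1 / α) L₀ b₀ b)
    (hT : 0 < T) (hα : 0 < α) (hα' : α < 1 / 2)
    (hB : (eLpNorm b₀ (ENNReal.ofReal (1 / α)) (volume.restrict (Icc 0 T))).toReal ≤ B)
    (hc : 0 < c) (hN : 0 ≤ N)
    (hxN : ∀ v ∈ Icc (-r) T, ‖x v‖ ≤ N * Real.exp (c * max v 0)) (htT : t ≤ T) :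
    ∀ s, 0 ≤ s → s ≤ t →
      ‖(∫ u in Ioo 0 t, b u ⟨(Icc (-r) T).domRestrict x, hx.cont.domRestrict⟩)
        - ∫ u in Ioo 0 s, b u ⟨(Icc (-r) T).domRestrict x, hx.cont.domRestrict⟩‖ₑ
        ≤ ENNReal.ofReal ((L₀ * c ^ (-α) * (N * Real.exp (c * t)) + B) * (t - s) ^ (1 - α)) := by
  intro s hs hst
  obtain ⟨X, hX⟩ : ∃ X : C(Icc (-r) T, Vec d),
    X = ⟨(Icc (-r) T).domRestrict x, hx.cont.domRestrict⟩ := ⟨_, rfl⟩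
  have hXN : ∀ v : Icc (-r) T, ‖X v‖ ≤ N * Real.exp (c * max (v : ℝ) 0) := by
    intro v
    rw [hX]
    exact hxN v v.2
  rw [← hX]
  exact h2.enorm_drift_sub_le hT hα hα' hB hc hN hXN hs hst htT

/-- One step of the a priori estimate: an exponential bound `N e^{ct}` on the norm of the solution
is improved to a bound with a small multiple of `N`. -/
lemma exists_pathNorm_step {d m : ℕ} {T α β γ φ M₀ K₀ L₀ B : ℝ} (hT : 0 < T) (hα : 0 < α)
    (hα' : α < 1 / 2) (hαβ : α < β) (hφ : IsPhi γ α φ) (hγ0 : 0 ≤ γ) (hγ1 : γ ≤ 1)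
    (hM : 0 < M₀) (hK : 0 < K₀) (hL : 0 < L₀) (hB0 : 0 ≤ B) :
    ∃ E₀ E₁ E₂ E₃ : ℝ, 0 ≤ E₀ ∧ 0 ≤ E₁ ∧ 0 ≤ E₂ ∧ 0 ≤ E₃ ∧
      ∀ (r δ : ℝ) (σ : ℝ → Vec d → Mat d m) (b₀ : ℝ → ℝ)
        (b : ℝ → C(Icc (-r) T, Vec d) → Vec d) (g : ℝ → Vec m) (η x : ℝ → Vec d),
        0 < r → H1 T β δ M₀ σ → H2 r T (1 / α) L₀ b₀ b →
        (eLpNorm b₀ (ENNReal.ofReal (1 / α)) (volume.restrict (Icc 0 T))).toReal ≤ B →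
        H3 T γ K₀ σ → MemDrv α T g → MemW α (-r) 0 η → IsSolution α r T b σ g η x →
        ∀ c N : ℝ, 1 ≤ c → 0 ≤ N →
          (∀ u ∈ Icc (-r) T,
            pathNorm α (-r) x u ≤ ENNReal.ofReal (N * Real.exp (c * max u 0))) →
          ∀ t ∈ Icc (-r) T, pathNorm α (-r) x t ≤
            ENNReal.ofReal ((wNorm α (-r) 0 η).toReal + E₀ + E₁ * Lam α T g +
              (E₂ * c ^ (-α) + E₃ * Lam α T g * c ^ (φ - 1)) *
                (N * Real.exp (c * max t 0))) := by
  have hα1 : α < 1 := by linarith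
  have p1 : 0 < 1 - 2 * α := by linarith
  have p3 : 0 < β - α := by linarith
  obtain ⟨Ca, Cb, hCa, hCb, hJ⟩ := exists_majorantConv_le (d := d) (m := m) hT hα hα' hγ0 hγ1 hφ
    hK.le (A := M₀ * (T ^ (β - α) / (β - α))) (by positivity) hM.le
  obtain ⟨P, hP⟩ : ∃ P : ℝ, P = T ^ α + 1 / α := ⟨_, rfl⟩
  obtain ⟨Q, hQ⟩ : ∃ Q : ℝ, Q = T ^ (1 - 2 * α) := ⟨_, rfl⟩
  obtain ⟨R, hR⟩ : ∃ R : ℝ, R = 1 / α + 4 * (2 ^ (2 * α) / α + 2 ^ (1 - α) / (1 - 2 * α)) :=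
    ⟨_, rfl⟩
  have hP0 : 0 ≤ P := by rw [hP]; positivity
  have hQ0 : 0 ≤ Q := by rw [hQ]; positivity
  have hR0 : 0 ≤ R := by rw [hR]; positivity
  -- In `IsSolution.pathNorm_le` the drift constant has coefficient PQ + Q/(1-2α), the convolution
  -- bound (P+R)Λ. Their N-free parts B and `Ca` give E₀ and E₁, the other parts E₂ and E₃.
  refine ⟨(P * Q + Q / (1 - 2 * α)) * B, (P + R) * Ca, (P * Q + Q / (1 - 2 * α)) * L₀,
    (P + R) * Cb, by positivity, by positivity, by positivity, by positivity, ?_⟩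
  intro r δ σ b₀ b g η x hr h1 h2 hB h3 hg hη hx c N hc hN hb t ht
  have hc0 : 0 < c := by linarith
  have hΛ := Lam_nonneg hα1 T g
  have hW0 : 0 ≤ (wNorm α (-r) 0 η).toReal := ENNReal.toReal_nonneg
  have hinit : ∀ s ∈ Icc (-r) 0,
      pathNorm α (-r) x s ≤ ENNReal.ofReal (wNorm α (-r) 0 η).toReal := by
    intro s hs
    rw [pathNorm_congr hs.1 (y := η) fun v hv => hx.init v ⟨hv.1, hv.2.trans hs.2⟩,
      ENNReal.ofReal_toReal hη.2.ne]
    exact pathNorm_le_wNorm η hs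
  rcases le_or_gt t 0 with ht0 | ht0
  · refine (hinit t ⟨ht.1, ht0⟩).trans (ENNReal.ofReal_le_ofReal ?_)
    rw [add_assoc, add_assoc]
    exact le_add_of_nonneg_right (by positivity)
  rw [max_eq_left ht0.le]
  have hxN : ∀ v ∈ Icc (-r) T, ‖x v‖ ≤ N * Real.exp (c * max v 0) := fun v hv =>
    norm_le_of_pathNorm_le (by positivity) (hb v hv)
  obtain ⟨f, hfc, hfeq⟩ : ∃ f : ℝ → Mat d m, Continuous f ∧
      EqOn (fun s => σ s (x (s - r))) f (Icc 0 T) :=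
    ⟨_, (h1.continuousOn_comp hr hx.cont).domRestrict.Icc_extend' (h := hT.le), fun s hs =>
      (IccExtend_of_mem hT.le ((Icc 0 T).domRestrict fun s => σ s (x (s - r))) hs).symm⟩
  have hJt : majorantConv α f t
      ≤ ENNReal.ofReal (Ca + Cb * c ^ (φ - 1) * (N * Real.exp (c * t))) := by
    refine hJ f c N t hc hN ht0 ht.2 (fun u hu => ?_) fun u hu => ?_
    · have hu' : u ∈ Icc 0 T := ⟨hu.1.le, hu.2.le.trans ht.2⟩
      rw [← hfeq hu']
      refine (h3.growth u hu' _).trans ?_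
      have h4 := hxN (u - r) ⟨by linarith [hu'.1], by linarith [hu'.2]⟩
      have h5 : max (u - r) 0 ≤ u := max_le (by linarith) hu'.1
      have h6 : ‖x (u - r)‖ ≤ N * Real.exp (c * u) := h4.trans (by gcongr)
      gcongr
    · have hu' : u ∈ Icc 0 T := ⟨hu.1.le, hu.2.le.trans ht.2⟩
      refine le_of_eq_of_le ?_ (h1.lintegral_comp_le_exp hT hr hαβ hc0.le hN hb hu.1 hu'.2)
      refine setLIntegral_congr_fun measurableSet_Ioo fun v hv => ?_
      rw [← hfeq hu', ← hfeq ⟨hv.1.le, hv.2.le.trans hu'.2⟩]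
  have hdrift := hx.enorm_drift_sub_le h2 hT hα hα' hB hc0 hN hxN ht.2
  have hj0 : 0 ≤ Ca + Cb * c ^ (φ - 1) * (N * Real.exp (c * t)) := by positivity
  have hD0 : 0 ≤ L₀ * c ^ (-α) * (N * Real.exp (c * t)) + B := by positivity
  have hmain := hx.pathNorm_le (driverBound_of_drvNorm_lt_top hg.2) hα hα' hr hT ⟨ht0, ht.2⟩
    hD0 hj0 hfc hfeq hJt hdrift
  rw [← hP, ← hQ, ← hR] at hmain
  refine hmain.trans ((add_le_add (add_le_add (hinit 0 ⟨by linarith, le_rfl⟩) le_rfl)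
    le_rfl).trans (le_of_eq ?_))
  rw [← ENNReal.ofReal_add hW0 (by positivity), ← ENNReal.ofReal_add (by positivity)
    (by positivity)]
  congr 1
  ring

/-! ### Absorption and the choice of c. -/

lemma mul_rpow_neg_le_one {a c p : ℝ} (ha : 0 ≤ a) (hp : 0 < p) (hc : 0 < c)
    (h : a ^ (1 / p) ≤ c) : a * c ^ (-p) ≤ 1 := by
  have h1 := Real.rpow_le_rpow (by positivity) h hp.le
  rw [← Real.rpow_mul ha, one_div_mul_cancel hp.ne', Real.rpow_one] at h1
  rw [Real.rpow_neg hc.le, ← div_eq_mul_inv, div_le_one (by positivity)]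
  exact h1

/-- A contraction estimate `N ↦ A + N/2` on the constant of an exponential bound makes `2A` an
admissible constant. -/
lemma pathNorm_le_of_contraction {E : Type*} [NormedAddCommGroup E] {α r T c A N₀ : ℝ}
    {x : ℝ → E} (hA : 0 ≤ A) (hc : 0 ≤ c) (hN₀ : 0 ≤ N₀)
    (h0 : ∀ u ∈ Icc (-r) T, pathNorm α (-r) x u ≤ ENNReal.ofReal N₀)
    (hstep : ∀ N : ℝ, 0 ≤ N →
      (∀ u ∈ Icc (-r) T, pathNorm α (-r) x u ≤ ENNReal.ofReal (N * Real.exp (c * max u 0))) →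
      ∀ u ∈ Icc (-r) T,
        pathNorm α (-r) x u ≤ ENNReal.ofReal ((A + N / 2) * Real.exp (c * max u 0)))
    {t : ℝ} (ht : t ∈ Icc (-r) T) :
    pathNorm α (-r) x t ≤ ENNReal.ofReal (2 * A * Real.exp (c * max t 0)) := by
  -- This is the explicit orbit of N ↦ A + N/2 about its fixed point 2A; its start 2A + N₀ is
  -- admissible because the weight is at least 1.
  have hn : ∀ n : ℕ, ∀ u ∈ Icc (-r) T,
      pathNorm α (-r) x u
        ≤ ENNReal.ofReal ((2 * A + N₀ * (1 / 2) ^ n) * Real.exp (c * max u 0)) := by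
    intro n
    induction n with
    | zero =>
      intro u hu
      refine (h0 u hu).trans (ENNReal.ofReal_le_ofReal ?_)
      have : 1 ≤ Real.exp (c * max u 0) :=
        Real.one_le_exp (mul_nonneg hc (le_max_right _ _))
      nlinarith
    | succ n ih =>
      intro u hu
      refine (hstep _ (by positivity) ih u hu).trans_eq ?_
      congr 2
      ring
  have hlim : Tendsto (fun n : ℕ =>
      ENNReal.ofReal ((2 * A + N₀ * (1 / 2) ^ n) * Real.exp (c * max t 0))) atTop
      (𝓝 (ENNReal.ofReal ((2 * A + N₀ * 0) * Real.exp (c * max t 0)))) :=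
    ENNReal.tendsto_ofReal (((tendsto_pow_atTop_nhds_zero_of_lt_one (by norm_num)
      (by norm_num)).const_mul N₀).const_add (2 * A) |>.mul_const _)
  rw [mul_zero, add_zero] at hlim
  exact ge_of_tendsto' hlim fun n => hn n t ht

end DelayEq

theorem lemma3p2 (d m : ℕ) (T α β γ φ M₀ K₀ L₀ B : ℝ)
    (hT : 0 < T) (hα : 0 < α) (hα' : α < 1 / 2) (hαβ : α < β)
    (hφ : DelayEq.IsPhi γ α φ) :
    ∃ C₁ C₂ C₃ : ℝ, 0 < C₁ ∧ 0 < C₂ ∧ 0 < C₃ ∧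
      ∀ (r δ : ℝ) (σ : ℝ → DelayEq.Vec d → DelayEq.Mat d m) (b₀ : ℝ → ℝ)
        (b : ℝ → C(Set.Icc (-r) T, DelayEq.Vec d) → DelayEq.Vec d)
        (g : ℝ → DelayEq.Vec m) (η x : ℝ → DelayEq.Vec d),
        0 < r →
        DelayEq.H1 T β δ M₀ σ →
        DelayEq.H2 r T (1 / α) L₀ b₀ b →
        (MeasureTheory.eLpNorm b₀ (ENNReal.ofReal (1 / α))
          (MeasureTheory.volume.restrict (Set.Icc 0 T))).toReal ≤ B →
        DelayEq.H3 T γ K₀ σ →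
        DelayEq.MemDrv α T g →
        DelayEq.MemW α (-r) 0 η →
        DelayEq.MemHolder (1 - α) (-r) 0 η →
        DelayEq.IsSolution α r T b σ g η x →
        (DelayEq.wNorm α (-r) T x).toReal ≤
          C₁ * ((DelayEq.wNorm α (-r) 0 η).toReal + DelayEq.Lam α T g + 1) *
            Real.exp (C₂ + C₃ * DelayEq.Lam α T g ^ (1 / (1 - φ))) := by
  -- The ranges of these parameters are recorded in the hypothesis structures. Outside them no data
  -- qualify and any positive constants serve.
  by_cases hpar : (0 ≤ γ ∧ γ ≤ 1) ∧ 0 < M₀ ∧ 0 < K₀ ∧ 0 < L₀ ∧ 0 ≤ B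
  swap
  · refine ⟨1, 1, 1, one_pos, one_pos, one_pos, ?_⟩
    intro r δ σ b₀ b g η x _ h1 h2 hB h3
    exact absurd ⟨⟨h3.gamma_nonneg, h3.gamma_le⟩, h1.const_pos, h3.const_pos, h2.const_pos,
      ENNReal.toReal_nonneg.trans hB⟩ hpar
  obtain ⟨⟨hγ0, hγ1⟩, hM, hK, hL, hB0⟩ := hpar
  obtain ⟨E₀, E₁, E₂, E₃, hE₀, hE₁, hE₂, hE₃, hstep⟩ := DelayEq.exists_pathNorm_step (d := d)
    (m := m) hT hα hα' hαβ hφ hγ0 hγ1 hM hK hL hB0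
  have hφ1 : 0 < 1 - φ := by linarith [hφ.lt_one hα hα' hγ1]
  -- The factors 4 make each of the two terms multiplying N at most 1/4; the summands 1 guarantee c
  -- ≥ 1 and positive final constants.
  set c₂ : ℝ := 1 + (4 * E₂) ^ (1 / α) with hc₂
  set c₃ : ℝ := 1 + (4 * E₃) ^ (1 / (1 - φ)) with hc₃
  have hc₂1 : 1 ≤ c₂ := le_add_of_nonneg_right (by positivity)
  have hc₃1 : 1 ≤ c₃ := le_add_of_nonneg_right (by positivity)
  refine ⟨2 * (1 + E₀ + E₁), c₂ * T, c₃ * T, by positivity, by positivity, by positivity, ?_⟩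
  intro r δ σ b₀ b g η x hr h1 h2 hB h3 hg hη _ hx
  have hΛ := DelayEq.Lam_nonneg (by linarith : α < 1) T g
  set Λ := DelayEq.Lam α T g with hΛdef
  set W := (DelayEq.wNorm α (-r) 0 η).toReal with hW
  have hW0 : 0 ≤ W := ENNReal.toReal_nonneg
  -- Making Λ c^{φ-1} small requires c of order Λ^{1/(1-φ)}, which is the origin of the exponent in
  -- the claim.
  set c : ℝ := c₂ + c₃ * Λ ^ (1 / (1 - φ)) with hc
  have hΛp : 0 ≤ Λ ^ (1 / (1 - φ)) := by positivity
  have hc1 : 1 ≤ c := hc₂1.trans (le_add_of_nonneg_right (by positivity))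
  have hc0 : 0 < c := by linarith
  have hsmall₂ : 4 * E₂ * c ^ (-α) ≤ 1 := by
    refine DelayEq.mul_rpow_neg_le_one (by positivity) hα hc0 ?_
    have : 0 ≤ c₃ * Λ ^ (1 / (1 - φ)) := by positivity
    linarith
  have hsmall₃ : 4 * E₃ * Λ * c ^ (-(1 - φ)) ≤ 1 := by
    refine DelayEq.mul_rpow_neg_le_one (by positivity) hφ1 hc0 ?_
    rw [Real.mul_rpow (by positivity) hΛ]
    nlinarith
  rw [neg_sub] at hsmall₃
  set A : ℝ := W + E₀ + E₁ * Λ with hA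
  have hA0 : 0 ≤ A := by positivity
  have hfin := hx.memW.2
  have hbound : ∀ t ∈ Icc (-r) T, DelayEq.pathNorm α (-r) x t
      ≤ ENNReal.ofReal (2 * A * Real.exp (c * max t 0)) := fun t ht => by
    refine DelayEq.pathNorm_le_of_contraction (N₀ := (DelayEq.wNorm α (-r) T x).toReal) hA0 hc0.le
      ENNReal.toReal_nonneg (fun u hu => ?_) (fun N hN hbd u hu => ?_) ht
    · rw [ENNReal.ofReal_toReal hfin.ne]
      exact DelayEq.pathNorm_le_wNorm x hu
    · refine (hstep r δ σ b₀ b g η x hr h1 h2 hB h3 hg hη hx c N hc1 hN hbd u hu).trans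
        (ENNReal.ofReal_le_ofReal ?_)
      have he : 1 ≤ Real.exp (c * max u 0) :=
        Real.one_le_exp (mul_nonneg hc0.le (le_max_right _ _))
      have hX : 0 ≤ N * Real.exp (c * max u 0) := by positivity
      have hE : E₂ * c ^ (-α) + E₃ * Λ * c ^ (φ - 1) ≤ 1 / 2 := by linarith
      have h5 := mul_le_mul_of_nonneg_right hE hX
      have h6 := mul_le_mul_of_nonneg_left he hA0
      linarith
  have hw : DelayEq.wNorm α (-r) T x ≤ ENNReal.ofReal (2 * A * Real.exp (c * T)) := by
    refine iSup₂_le fun t ht => (hbound t ht).trans (ENNReal.ofReal_le_ofReal ?_)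
    have : max t 0 ≤ T := max_le ht.2 hT.le
    gcongr
  refine (ENNReal.toReal_le_of_le_ofReal (by positivity) hw).trans ?_
  have hexp : c * T = c₂ * T + c₃ * T * Λ ^ (1 / (1 - φ)) := by rw [hc]; ring
  rw [hexp]
  refine mul_le_mul_of_nonneg_right ?_ (Real.exp_pos _).le
  have q1 : 0 ≤ E₀ * W := by positivity
  have q2 : 0 ≤ E₀ * Λ := by positivity
  have q3 : 0 ≤ E₁ * W := by positivity
  rw [hA]
  linarith
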